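/- Let $T_0,R_0,\rho_0>0$, write $D_r=\{y\in\mathbb C: |y|<r\}$, and let $F(t,x,z_1,z_2)$ be a continuous function on $\Omega=[0,T_0]\times D_{R_0}\times D_{\rho_0}\times D_{\rho_0}$ (with $t$ real and $x,z_1,z_2$ complex) which is holomorphic in $(x,z_1,z_2)$ for every fixed $t$ and satisfies $F(0,x,0,0)=0$ and $\frac{\partial F}{\partial z_2}(0,x,0,0)=0$ on $D_{R_0}$. Put $a(t,x)=F(t,x,0,0)$, $\lambda(t,x)=\frac{\partial F}{\partial z_1}(t,x,0,0)$, $b(t,x)=\frac{\partial F}{\partial z_2}(t,x,0,0)$, let $R(t,x,z_1,z_2)=F(t,x,z_1,z_2)-a(t,x)-\lambda(t,x)z_1-b(t,x)z_2$ be the part of order at least $2$ of the Taylor series of $F$ in $(z_1,z_2)$, and consider the equation $$t\,\frac{\partial u}{\partial t}=a(t,x)+\lambda(t,x)u+b(t,x)\frac{\partial u}{\partial x}+R\Bigl(t,x,u,\frac{\partial u}{\partial x}\Bigr).\tag{2.1}$$ A weight function on $(0,T_0]$ is a continuous, positive, increasing function $\mu(t)$ on $(0,T_0]$ with $\int_0^{T_0}\frac{\mu(\tau)}{\tau}\,d\tau<\infty$.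 Function classes. For $T,R>0$, $X_0([0,T]\times D_R)$ is the set of continuous functions on $[0,T]\times D_R$ that are holomorphic in $x$ for each fixed $t$; $X_1([0,T]\times D_R)$ is the set of $f\in X_0([0,T]\times D_R)$ that are $C^1$ for $0<t<T$ and satisfy $t\,\partial f/\partial t\in X_0([0,T]\times D_R)$. For $d>0$, $X_1^d([0,T]\times D_R)$ is the set of $u\in X_1([0,T]\times D_R)$ with $\max\{|u|,|\partial u/\partial x|\}\le Ct^d$ on $[0,T]\times D_R$ for some $C>0$. $X_1^d$ is the set of germs at $(t,x)=(0,0)$ (two functions being identified if they agree on $[0,\epsilon]\times D_\delta$ for some $\epsilon,\delta>0$) of functions that belong to $X_1^d([0,T]\times D_R)$ for some $T,R>0$, and $X_1^{(d)}=\bigcap_{0<a<d}X_1^a$. A germ is a solution of (2.1) if it has a representative in $X_1([0,T]\times D_R)$, for some $0<T\le T_0$ and $0<R\le R_0$, with $|u|<\rho_0$ and $|\partial u/\partial x|<\rho_0$, which satisfies (2.1) on $[0,T]\times D_R$. **Theorem 4.1.** Suppose that for some constants $A,B,\mu>0$ and some weight function $\mu(t)$ on $(0,T_0]$ we have $|a(t,x)|\le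 A\,t^{\mu}$ on $[0,T_0]\times D_{R_0}$ and $|b(t,x)|\le B\,\mu(t)$ on $(0,T_0]\times D_{R_0}$, and that $0<\mu\le \operatorname{Re}\lambda(0,0)$. Then (2.1) has a solution in $X_1^{\mu}$ if $\mu<\operatorname{Re}\lambda(0,0)$, and it has a solution in $X_1^{(\mu)}$ if $\mu=\operatorname{Re}\lambda(0,0)$. -/

import Mathlib

open Set Filter Topology MeasureTheory

noncomputable section

namespace BriotBouquet

/-- The standing conditions on the right-hand side `F(t,x,z₁,z₂)`, a function on
`Ω = [0,T₀] × D_{R₀} × D_{ρ₀} × D_{ρ₀}` (values of `F` outside `Ω` play no role):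
continuity on `Ω`, holomorphy in `(x,z₁,z₂)` for fixed `t`, `F(0,x,0,0) = 0` and
`∂F/∂z₂(0,x,0,0) = 0`. -/
structure Conditions (T₀ R₀ ρ₀ : ℝ) (F : ℝ → ℂ → ℂ → ℂ → ℂ) : Prop where
  continuousOn : ContinuousOn (fun p : ℝ × ℂ × ℂ × ℂ => F p.1 p.2.1 p.2.2.1 p.2.2.2)
    (Icc 0 T₀ ×ˢ Metric.ball 0 R₀ ×ˢ Metric.ball 0 ρ₀ ×ˢ Metric.ball 0 ρ₀)
  holomorphic : ∀ t ∈ Icc 0 T₀,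
    DifferentiableOn ℂ (fun p : ℂ × ℂ × ℂ => F t p.1 p.2.1 p.2.2)
      (Metric.ball 0 R₀ ×ˢ Metric.ball 0 ρ₀ ×ˢ Metric.ball 0 ρ₀)
  zero_at_zero : ∀ x ∈ Metric.ball (0 : ℂ) R₀, F 0 x 0 0 = 0
  deriv_zero_at_zero : ∀ x ∈ Metric.ball (0 : ℂ) R₀, deriv (fun z₂ => F 0 x 0 z₂) 0 = 0

/-- `a(t,x) = F(t,x,0,0)`. -/
def coeffA (F : ℝ → ℂ → ℂ → ℂ → ℂ) (t : ℝ) (x : ℂ) : ℂ := F t x 0 0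

/-- `λ(t,x) = ∂F/∂z₁(t,x,0,0)`. -/
def coeffLambda (F : ℝ → ℂ → ℂ → ℂ → ℂ) (t : ℝ) (x : ℂ) : ℂ := deriv (fun z₁ => F t x z₁ 0) 0

/-- `b(t,x) = ∂F/∂z₂(t,x,0,0)`. -/
def coeffB (F : ℝ → ℂ → ℂ → ℂ → ℂ) (t : ℝ) (x : ℂ) : ℂ := deriv (fun z₂ => F t x 0 z₂) 0

/-- `R(t,x,z₁,z₂)`, the part of order at least two of the Taylor series of `F` in `(z₁,z₂)`:
what is left of `F` after its terms of order zero and one are taken away. -/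
def remainder (F : ℝ → ℂ → ℂ → ℂ → ℂ) (t : ℝ) (x z₁ z₂ : ℂ) : ℂ :=
  F t x z₁ z₂ - (coeffA F t x + coeffLambda F t x * z₁ + coeffB F t x * z₂)

/-- Weight functions on `(0,T₀]`: continuous, positive, increasing, with `μ(τ)/τ` integrable
on `(0,T₀]`. -/
structure IsWeight (T₀ : ℝ) (m : ℝ → ℝ) : Prop where
  continuousOn : ContinuousOn m (Ioc 0 T₀)
  monotoneOn : MonotoneOn m (Ioc 0 T₀)
  pos : ∀ t ∈ Ioc 0 T₀, 0 < m t
  integrable : IntegrableOn (fun τ => m τ / τ) (Ioc 0 T₀)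

/-- `X₀([0,T] × D_R)`: continuous on `[0,T] × D_R` and holomorphic in `x` for fixed `t`. -/
structure MemX0 (T R : ℝ) (f : ℝ → ℂ → ℂ) : Prop where
  continuousOn : ContinuousOn (fun p : ℝ × ℂ => f p.1 p.2) (Icc 0 T ×ˢ Metric.ball 0 R)
  holomorphic : ∀ t ∈ Icc 0 T, DifferentiableOn ℂ (f t) (Metric.ball 0 R)

/-- `(t ∂f/∂t)(t,x)` on `[0,T]`; the derivative is one-sided at `t = T`, and the value at `t = 0`
is `0`, the only one for which `t ∂f/∂t` can be continuous if `f` is continuous up to `t = 0`. -/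
def eulerT (T : ℝ) (f : ℝ → ℂ → ℂ) (t : ℝ) (x : ℂ) : ℂ :=
  (t : ℂ) * derivWithin (fun s => f s x) (Icc 0 T) t

/-- `X₁([0,T] × D_R)`: `C¹` for `0 < t < T`, with `f` and `t ∂f/∂t` in `X₀([0,T] × D_R)`. -/
structure MemX1 (T R : ℝ) (f : ℝ → ℂ → ℂ) : Prop where
  memX0 : MemX0 T R f
  contDiffOn : ContDiffOn ℝ 1 (fun p : ℝ × ℂ => f p.1 p.2) (Ioo 0 T ×ˢ Metric.ball 0 R)
  differentiable_t : ∀ t ∈ Ioc 0 T, ∀ x ∈ Metric.ball (0 : ℂ) R,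
    DifferentiableWithinAt ℝ (fun s => f s x) (Icc 0 T) t
  memX0_eulerT : MemX0 T R (eulerT T f)

/-- `X₁^d([0,T] × D_R)`: moreover `max {|f|, |∂f/∂x|} ≤ C t^d` on `[0,T] × D_R`. -/
structure MemX1Pow (d T R : ℝ) (f : ℝ → ℂ → ℂ) : Prop where
  memX1 : MemX1 T R f
  bound : ∃ C : ℝ, 0 < C ∧ ∀ t ∈ Icc 0 T, ∀ x ∈ Metric.ball (0 : ℂ) R,
    max ‖f t x‖ ‖deriv (f t) x‖ ≤ C * t ^ d

/-- Germs at the origin of functions of `(t,x)`, `t ≥ 0`: two functions are identified if they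
agree on `[0,ε] × D_δ` for some `ε, δ > 0`. -/
abbrev OriginGerm : Type := Germ (𝓝[≥] (0 : ℝ) ×ˢ 𝓝 (0 : ℂ)) ℂ

/-- The germ of a function of `(t,x)`. -/
def germ (f : ℝ → ℂ → ℂ) : OriginGerm := ((fun p : ℝ × ℂ => f p.1 p.2 : ℝ × ℂ → ℂ) : OriginGerm)

/-- `X₁^d`, the inductive limit of the spaces `X₁^d([0,T] × D_R)`. -/
def X1Pow (d : ℝ) : Set OriginGerm :=
  {g | ∃ T R : ℝ, ∃ f : ℝ → ℂ → ℂ, 0 < T ∧ 0 < R ∧ MemX1Pow d T R f ∧ g = germ f}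

/-- `X₁^{(d)}`, the intersection of the `X₁^a` with `0 < a < d`. -/
def X1Below (d : ℝ) : Set OriginGerm := ⋂ a ∈ Ioo 0 d, X1Pow a

/-- `u` is a solution on `[0,T] × D_R` of
`t ∂u/∂t = a(t,x) + λ(t,x) u + b(t,x) ∂u/∂x + R(t,x,u,∂u/∂x)`;
all arguments of the right-hand side have to lie in the domain of `F`. -/
structure IsSolution (T₀ R₀ ρ₀ : ℝ) (F : ℝ → ℂ → ℂ → ℂ → ℂ) (T R : ℝ) (u : ℝ → ℂ → ℂ) :
    Prop where
  T_le : T ≤ T₀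
  R_le : R ≤ R₀
  memX1 : MemX1 T R u
  norm_lt : ∀ t ∈ Icc 0 T, ∀ x ∈ Metric.ball (0 : ℂ) R, ‖u t x‖ < ρ₀
  norm_deriv_lt : ∀ t ∈ Icc 0 T, ∀ x ∈ Metric.ball (0 : ℂ) R, ‖deriv (u t) x‖ < ρ₀
  equation : ∀ t ∈ Icc 0 T, ∀ x ∈ Metric.ball (0 : ℂ) R,
    eulerT T u t x = coeffA F t x + coeffLambda F t x * u t x + coeffB F t x * deriv (u t) x
      + remainder F t x (u t x) (deriv (u t) x)

/-- The set of all solutions (as germs) of the equation that belong to the class `X`. -/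
def solutions (T₀ R₀ ρ₀ : ℝ) (F : ℝ → ℂ → ℂ → ℂ → ℂ) (X : Set OriginGerm) : Set OriginGerm :=
  {g | g ∈ X ∧ ∃ T R : ℝ, ∃ u : ℝ → ℂ → ℂ, 0 < T ∧ 0 < R ∧
    IsSolution T₀ R₀ ρ₀ F T R u ∧ g = germ u}

end BriotBouquet

end

/-!
Solutions are constructed from `t = T` down to `t = 0`, with the initial condition `u(T,x) = 0`.
With `λ = λ(0,0)` and `g(t,x) = F(t,x,u,∂u/∂x) - λ u`, the equation reads `t ∂u/∂t = λ u + g` and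
becomes the integral equation
`u(t,x) = -t^λ ∫_t^T τ^(-λ-1) g(τ,x) dτ` (`duhamel`). Since `Re λ > a > 0`, this operator preserves
the decay `t^a`. The difficulty is the loss of a derivative in `∂u/∂x`.

The loss is handled by Nagumo's method on discs whose radius grows with `t`. Near the origin
`F - λ z₁` is Lipschitz with a small constant `ε` in `z₁`, and with constant
`ψ(t) = B m(t) + C M t^c` in `z₂`, as long as `|z₁|, |z₂| ≤ M t^c`
(`Conditions.exists_lipschitz_rpow`); `ψ` is a weight function again, so that
`φ(t) = ∫₀ᵗ ψ(τ)/τ dτ` is finite. On `|x| < r(t)`, `r(t) = const + 64 φ(t)`, put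
`d(t,x) = r(t) - |x|`. If `|v| ≤ N t^a / d`, then `|∂v/∂x| ≤ 4 N t^a / d²` by Cauchy's estimate, and
the identity `-∂/∂τ [τ^(a-Λ) / d] = τ^(a-Λ-1) [(Λ-a)/d + 64 ψ/d²]`, `Λ = Re λ`, shows that the
operator maps a right-hand side of size `ε |v| + ψ |∂v/∂x|`, with `ε = (Λ-a)/16`, to a
function bounded by `(N/16) t^a / d` (`norm_cpow_mul_integral_le`). The successive
approximations thus converge with ratio `1/16`; shrinking the disc by `R/2^(n+1)` in the `n`-th step
costs a factor `4` for the derivatives, which the ratio pays for, so that all approximations and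
their derivatives remain bounded by `M t^a` (`IsContractive.exists_isPowSolution`).

If `μ < Re λ(0,0)`, the theorem follows with `a = μ`. If `μ = Re λ(0,0)`, the solution belonging to
`a = μ/2` also decays like `t^a` for each `a < μ`, on a domain that depends on `a`: on `[t₀,T]` it
satisfies a bound `N t^a / d` with a constant that depends on `t₀`, and the same estimate improves
`N` to `D + N/16` with `D` independent of `t₀` (`IsPowSolution.improve`), whence the bound with
`2 D` (`IsPowSolution.exists_of_lt`).
-/

noncomputable section

namespace BriotBouquet

open Metric (ball closedBall)

/-! ### Holomorphic functions of one variable -/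

lemma norm_deriv_le_of_norm_le_ball {f : ℂ → ℂ} {x : ℂ} {r C : ℝ} (hr : 0 < r)
    (hf : DifferentiableOn ℂ f (ball x r)) (hC : ∀ z ∈ ball x r, ‖f z‖ ≤ C) :
    ‖deriv f x‖ ≤ C / r := by
  rw [le_div_iff₀ hr]
  have hlim : Tendsto (fun s : ℝ => ‖deriv f x‖ * s) (𝓝[<] r) (𝓝 (‖deriv f x‖ * r)) :=
    ((continuous_const.mul continuous_id).tendsto r).mono_left nhdsWithin_le_nhds
  refine le_of_tendsto hlim ?_
  filter_upwards [Ioo_mem_nhdsLT hr] with s hs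
  rw [← le_div_iff₀ hs.1]
  refine Complex.norm_deriv_le_of_forall_mem_sphere_norm_le hs.1 ?_ fun z hz => hC z ?_
  · exact hf.diffContOnCl_ball (Metric.closedBall_subset_ball hs.2)
  · exact Metric.closedBall_subset_ball hs.2 (Metric.sphere_subset_closedBall hz)

lemma norm_deriv_le_of_norm_le {f : ℂ → ℂ} {ρ M : ℝ}
    (hf : DifferentiableOn ℂ f (ball 0 ρ)) (hM : ∀ z ∈ ball (0 : ℂ) ρ, ‖f z‖ ≤ M)
    {z : ℂ} (hz : z ∈ ball (0 : ℂ) (ρ / 2)) : ‖deriv f z‖ ≤ 2 * M / ρ := by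
  rw [mem_ball_zero_iff] at hz
  have hρ : 0 < ρ := by linarith [norm_nonneg z]
  have hs : ball z (ρ / 2) ⊆ ball 0 ρ := Metric.ball_subset_ball' (by
    rw [dist_zero_right]; linarith)
  refine (norm_deriv_le_of_norm_le_ball (half_pos hρ) (hf.mono hs) fun w hw => hM w (hs hw)).trans
    (le_of_eq ?_)
  field_simp

lemma norm_sub_le_of_norm_le {f : ℂ → ℂ} {ρ M : ℝ}
    (hf : DifferentiableOn ℂ f (ball 0 ρ)) (hM : ∀ z ∈ ball (0 : ℂ) ρ, ‖f z‖ ≤ M)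
    {z w : ℂ} (hz : z ∈ ball (0 : ℂ) (ρ / 2)) (hw : w ∈ ball (0 : ℂ) (ρ / 2)) :
    ‖f z - f w‖ ≤ 2 * M / ρ * ‖z - w‖ := by
  have hρ : 0 < ρ := by
    rw [mem_ball_zero_iff] at hz; linarith [norm_nonneg z]
  exact Convex.norm_image_sub_le_of_norm_deriv_le (s := ball (0 : ℂ) (ρ / 2))
    (fun y hy => hf.differentiableAt (Metric.isOpen_ball.mem_nhds
      (Metric.ball_subset_ball (by linarith) hy)))
    (fun y hy => norm_deriv_le_of_norm_le hf hM hy) (convex_ball _ _) hw hz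

/-- Nagumo's form of Cauchy's estimate: a blow-up of order one at the boundary of a disc becomes,
for the derivative, a blow-up of order two. -/
lemma norm_deriv_le_of_norm_le_div {f : ℂ → ℂ} {r N : ℝ} (hN : 0 ≤ N)
    (hf : DifferentiableOn ℂ f (ball 0 r)) (hC : ∀ z ∈ ball (0 : ℂ) r, ‖f z‖ ≤ N / (r - ‖z‖))
    {x : ℂ} (hx : x ∈ ball (0 : ℂ) r) : ‖deriv f x‖ ≤ 4 * N / (r - ‖x‖) ^ 2 := by
  rw [mem_ball_zero_iff] at hx
  have hd : 0 < r - ‖x‖ := by linarith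
  have hs : ball x ((r - ‖x‖) / 2) ⊆ ball 0 r := Metric.ball_subset_ball' (by
    rw [dist_zero_right]; linarith)
  refine (norm_deriv_le_of_norm_le_ball (C := N / ((r - ‖x‖) / 2)) (half_pos hd) (hf.mono hs)
    fun w hw => (hC w (hs hw)).trans ?_).trans (le_of_eq ?_)
  · rw [Metric.mem_ball, dist_eq_norm] at hw
    have := norm_le_norm_add_norm_sub' w x
    gcongr
    linarith
  · field_simp; ring

/-- The derivative of a holomorphic function depends continuously on parameters. -/
lemma continuousOn_deriv_param {P : Type*} [TopologicalSpace P] {A : Set P} {f : P → ℂ → ℂ}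
    {c : ℂ} {s : ℝ} (hf : ContinuousOn (fun q : P × ℂ => f q.1 q.2) (A ×ˢ ball c s))
    (hd : ∀ p ∈ A, DifferentiableOn ℂ (f p) (ball c s)) :
    ContinuousOn (fun q : P × ℂ => deriv (f q.1) q.2) (A ×ˢ ball c s) := by
  rintro ⟨p₀, x₀⟩ ⟨hp₀, hx₀⟩
  simp only at hp₀ hx₀
  obtain ⟨d, hd0, hdb⟩ : ∃ d > 0, closedBall x₀ (2 * d) ⊆ ball c s := by
    obtain ⟨e, he, hes⟩ := Metric.nhds_basis_closedBall.mem_iff.1 (Metric.isOpen_ball.mem_nhds hx₀)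
    exact ⟨e / 2, half_pos he, by rwa [mul_div_cancel₀ _ two_ne_zero]⟩
  have hc0 : ContinuousAt (deriv (f p₀)) x₀ :=
    (((hd p₀ hp₀).deriv Metric.isOpen_ball).continuousOn.continuousAt
      (Metric.isOpen_ball.mem_nhds hx₀))
  rw [Metric.continuousWithinAt_iff']
  intro ε hε
  obtain ⟨v, hv, hvk⟩ := (isCompact_closedBall x₀ (2 * d)).mem_uniformity_of_prod (f := f)
    (hf.mono (prod_mono_right hdb)) hp₀
    (Metric.dist_mem_uniformity (ε := ε / 3 * d) (by positivity))
  have h1 : ∀ᶠ q : P × ℂ in 𝓝[A ×ˢ ball c s] (p₀, x₀), q.1 ∈ v ∧ q.1 ∈ A := by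
    rw [nhdsWithin_prod_eq]
    have : ∀ᶠ p in 𝓝[A] p₀, p ∈ v ∧ p ∈ A := inter_mem hv self_mem_nhdsWithin
    exact tendsto_fst.eventually this
  have h2 : ∀ᶠ q : P × ℂ in 𝓝[A ×ˢ ball c s] (p₀, x₀),
      dist q.2 x₀ < d ∧ dist (deriv (f p₀) q.2) (deriv (f p₀) x₀) < ε / 2 := by
    have : ∀ᶠ x in 𝓝 x₀, dist x x₀ < d ∧ dist (deriv (f p₀) x) (deriv (f p₀) x₀) < ε / 2 :=
      inter_mem (Metric.ball_mem_nhds x₀ hd0)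
        (Metric.continuousAt_iff'.1 hc0 (ε / 2) (half_pos hε))
    exact ((continuous_snd.tendsto (p₀, x₀)).mono_left nhdsWithin_le_nhds).eventually this
  filter_upwards [h1, h2] with q hq1 hq2
  have hsub : ball q.2 d ⊆ closedBall x₀ (2 * d) := fun z hz => by
    rw [Metric.mem_closedBall]
    rw [Metric.mem_ball] at hz
    linarith [dist_triangle z q.2 x₀]
  have hdp := (hd q.1 hq1.2).mono (hsub.trans hdb)
  have hd0' := (hd p₀ hp₀).mono (hsub.trans hdb)
  have key : ‖deriv (fun z => f q.1 z - f p₀ z) q.2‖ ≤ ε / 3 * d / d := by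
    refine norm_deriv_le_of_norm_le_ball hd0 (hdp.sub hd0') fun z hz => ?_
    have := hvk q.1 hq1.1 z (hsub hz)
    rw [mem_ofPred_eq, dist_eq_norm] at this
    exact this.le
  have hnb : ball q.2 d ∈ 𝓝 q.2 := Metric.ball_mem_nhds _ hd0
  rw [deriv_fun_sub (hdp.differentiableAt hnb) (hd0'.differentiableAt hnb), ← dist_eq_norm,
    mul_div_cancel_right₀ _ hd0.ne'] at key
  have := dist_triangle (deriv (f q.1) q.2) (deriv (f p₀) q.2) (deriv (f p₀) x₀)
  linarith [hq2.2]

/-! ### Integrals of holomorphic functions over a real parameter -/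

lemma continuousOn_integral_param {t₁ T ρ : ℝ} {h : ℝ → ℂ → ℂ} (hT : t₁ ≤ T)
    (hh : ContinuousOn (fun p : ℝ × ℂ => h p.1 p.2) (Icc t₁ T ×ˢ ball 0 ρ)) :
    ContinuousOn (fun p : ℝ × ℂ => ∫ τ in p.1..T, h τ p.2) (Icc t₁ T ×ˢ ball 0 ρ) := by
  let k : ↥(Icc t₁ T ×ˢ ball (0 : ℂ) ρ) → ℝ → ℂ := fun p τ => h (projIcc t₁ T hT τ) p.1.2
  have hk : Continuous k.uncurry := by
    refine hh.comp_continuous (f := fun q : ↥(Icc t₁ T ×ˢ ball (0 : ℂ) ρ) × ℝ =>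
      ((projIcc t₁ T hT q.2 : ℝ), q.1.1.2)) ?_ ?_
    · fun_prop
    · exact fun q => ⟨(projIcc t₁ T hT q.2).2, q.1.2.2⟩
  have h1 : Continuous fun p : ↥(Icc t₁ T ×ˢ ball (0 : ℂ) ρ) => -∫ τ in T..p.1.1, k p τ :=
    (intervalIntegral.continuous_parametric_intervalIntegral_of_continuous (a₀ := T) hk
      (s := fun p => p.1.1) (by fun_prop)).neg
  rw [continuousOn_iff_continuous_domRestrict]
  refine h1.congr fun p => ?_
  rw [← intervalIntegral.integral_symm, Set.domRestrict_apply]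
  refine intervalIntegral.integral_congr fun τ hτ => ?_
  rw [uIcc_of_le p.2.1.2] at hτ
  simp only [k, projIcc_of_mem hT ⟨p.2.1.1.trans hτ.1, hτ.2⟩]

lemma differentiableOn_integral_param {t T ρ : ℝ} {h : ℝ → ℂ → ℂ} (hT : t ≤ T)
    (hh : ContinuousOn (fun p : ℝ × ℂ => h p.1 p.2) (Icc t T ×ˢ ball 0 ρ))
    (hd : ∀ τ ∈ Icc t T, DifferentiableOn ℂ (h τ) (ball 0 ρ)) :
    DifferentiableOn ℂ (fun x => ∫ τ in t..T, h τ x) (ball 0 ρ) := by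
  intro x₀ hx₀
  refine DifferentiableAt.differentiableWithinAt ?_
  obtain ⟨e, he, hes⟩ := Metric.nhds_basis_closedBall.mem_iff.1 (Metric.isOpen_ball.mem_nhds hx₀)
  have hder := continuousOn_deriv_param hh hd
  obtain ⟨C, hC⟩ := (isCompact_Icc.prod (isCompact_closedBall x₀ e)).exists_bound_of_continuousOn
    (hder.mono (prod_mono_right hes))
  have hsub : uIoc t T ⊆ Icc t T := by rw [uIoc_of_le hT]; exact Ioc_subset_Icc_self
  have hcont : ∀ x ∈ ball (0 : ℂ) ρ, ContinuousOn (fun τ => h τ x) (Icc t T) := fun x hx =>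
    hh.comp (f := fun τ => (τ, x)) (by fun_prop) fun τ hτ => ⟨hτ, hx⟩
  have hcont' : ContinuousOn (fun τ => deriv (h τ) x₀) (Icc t T) :=
    hder.comp (f := fun τ => (τ, x₀)) (by fun_prop) fun τ hτ => ⟨hτ, hx₀⟩
  refine (intervalIntegral.hasDerivAt_integral_of_dominated_loc_of_deriv_le
    (F := fun x τ => h τ x) (F' := fun x τ => deriv (h τ) x) (bound := fun _ => C)
    (s := closedBall x₀ e) (Metric.closedBall_mem_nhds x₀ he) ?_ ?_ ?_ ?_ ?_ ?_).2.differentiableAt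
  · filter_upwards [Metric.isOpen_ball.mem_nhds hx₀] with x hx
    exact ((hcont x hx).mono hsub).aestronglyMeasurable measurableSet_uIoc
  · exact (hcont x₀ hx₀).intervalIntegrable_of_Icc hT
  · exact (hcont'.mono hsub).aestronglyMeasurable measurableSet_uIoc
  · exact .of_forall fun τ hτ x hx => hC (τ, x) ⟨hsub hτ, hx⟩
  · exact intervalIntegrable_const
  · exact .of_forall fun τ hτ x hx => ((hd τ (hsub hτ)).differentiableAt
      (Metric.isOpen_ball.mem_nhds (hes hx))).hasDerivAt

/-- A function of a real and a complex variable whose two partial derivatives are continuous is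
continuously differentiable. -/
lemma contDiffOn_one_of_partials {u ut ux : ℝ → ℂ → ℂ} {U : Set (ℝ × ℂ)} (hU : IsOpen U)
    (ht : ∀ p ∈ U, HasDerivAt (fun s => u s p.2) (ut p.1 p.2) p.1)
    (hx : ∀ p ∈ U, HasDerivAt (u p.1) (ux p.1 p.2) p.2)
    (hct : ContinuousOn (fun p : ℝ × ℂ => ut p.1 p.2) U)
    (hcx : ContinuousOn (fun p : ℝ × ℂ => ux p.1 p.2) U) :
    ContDiffOn ℝ 1 (fun p : ℝ × ℂ => u p.1 p.2) U := by
  let f₁ : ℝ → ℂ → ℝ →L[ℝ] ℂ := fun t x => ContinuousLinearMap.toSpanSingleton ℝ (ut t x)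
  let f₂ : ℝ → ℂ → ℂ →L[ℝ] ℂ := fun t x =>
    (ContinuousLinearMap.toSpanSingleton ℂ (ux t x)).restrictScalars ℝ
  have hc₁ : ContinuousOn (fun p : ℝ × ℂ => f₁ p.1 p.2) U :=
    (ContinuousLinearMap.toSpanSingletonCLE (𝕜 := ℝ) (E := ℂ)).continuous.comp_continuousOn hct
  have hc₂ : ContinuousOn (fun p : ℝ × ℂ => f₂ p.1 p.2) U :=
    (ContinuousLinearMap.continuous_restrictScalars (𝕜' := ℝ) (E := ℂ) (F := ℂ)
      (𝕜 := ℂ)).comp_continuousOn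
      ((ContinuousLinearMap.toSpanSingletonCLE (𝕜 := ℂ) (E := ℂ)).continuous.comp_continuousOn hcx)
  have hmain : ∀ p ∈ U, HasFDerivAt (fun p : ℝ × ℂ => u p.1 p.2)
      ((f₁ p.1 p.2).coprod (f₂ p.1 p.2)) p := fun p hp =>
    (hasStrictFDerivAt_uncurry_coprod (𝕜 := ℝ) (f := u) (f₁ := f₁) (f₂ := f₂)
      (by filter_upwards [hU.mem_nhds hp] with v hv using (ht v hv).hasFDerivAt)
      (by
        filter_upwards [hU.mem_nhds hp] with v hv
        exact (hx v hv).hasFDerivAt.restrictScalars ℝ)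
      (hc₁.continuousAt (hU.mem_nhds hp)) (hc₂.continuousAt (hU.mem_nhds hp))).hasFDerivAt
  have h01 : (1 : WithTop ℕ∞) = 0 + 1 := by norm_num
  rw [h01, contDiffOn_succ_iff_fderiv_of_isOpen hU]
  refine ⟨fun p hp => (hmain p hp).differentiableAt.differentiableWithinAt, by simp, ?_⟩
  rw [contDiffOn_zero]
  have : ContinuousOn (fun p : ℝ × ℂ => (f₁ p.1 p.2).coprod (f₂ p.1 p.2)) U := by
    simp only [← ContinuousLinearMap.comp_fst_add_comp_snd]
    exact (hc₁.clm_comp continuousOn_const).add (hc₂.clm_comp continuousOn_const)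
  exact this.congr fun p hp => (hmain p hp).fderiv

/-! ### Lipschitz estimates for the right-hand side -/

/-- In the second variable, a bounded holomorphic function of two variables differs from its
linearization at the origin by a function with Lipschitz constant `O(σ)` on the bidisc of
radius `σ`. -/
lemma norm_sub_sub_deriv_mul_le {f : ℂ → ℂ → ℂ} {ρ M σ : ℝ} (hσ : σ < ρ / 4)
    (h₁ : ∀ z₂ ∈ ball (0 : ℂ) ρ, DifferentiableOn ℂ (fun z₁ => f z₁ z₂) (ball 0 ρ))
    (h₂ : ∀ z₁ ∈ ball (0 : ℂ) ρ, DifferentiableOn ℂ (f z₁) (ball 0 ρ))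
    (hM : ∀ z₁ ∈ ball (0 : ℂ) ρ, ∀ z₂ ∈ ball (0 : ℂ) ρ, ‖f z₁ z₂‖ ≤ M)
    {z₁ z₂ w₂ : ℂ} (hz₁ : ‖z₁‖ ≤ σ) (hz₂ : ‖z₂‖ ≤ σ) (hw₂ : ‖w₂‖ ≤ σ) :
    ‖f z₁ z₂ - f z₁ w₂ - deriv (f 0) 0 * (z₂ - w₂)‖ ≤ 16 * M / ρ ^ 2 * σ * ‖z₂ - w₂‖ := by
  have hσ0 : 0 ≤ σ := (norm_nonneg _).trans hz₁
  have hρ : 0 < ρ := by linarith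
  have h0 : (0 : ℂ) ∈ ball (0 : ℂ) ρ := Metric.mem_ball_self hρ
  have hM0 : 0 ≤ M := (norm_nonneg _).trans (hM 0 h0 0 h0)
  have hmem : ∀ {z : ℂ}, ‖z‖ ≤ σ → z ∈ ball (0 : ℂ) (ρ / 2) := fun hz => by
    rw [mem_ball_zero_iff]; linarith
  have hmem' : ∀ {z : ℂ}, ‖z‖ ≤ σ → z ∈ ball (0 : ℂ) ρ := fun hz => by
    rw [mem_ball_zero_iff]; linarith
  -- The increment in `z₂`, as a function of `z₁`, is bounded by a multiple of `|z₂ - w₂|`.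
  have hA : ‖(f z₁ z₂ - f z₁ w₂) - (f 0 z₂ - f 0 w₂)‖ ≤
      2 * (2 * M / ρ * ‖z₂ - w₂‖) / ρ * ‖z₁ - 0‖ :=
    norm_sub_le_of_norm_le (f := fun z => f z z₂ - f z w₂)
      ((h₁ z₂ (hmem' hz₂)).sub (h₁ w₂ (hmem' hw₂)))
      (fun z hz => norm_sub_le_of_norm_le (h₂ z hz) (hM z hz) (hmem hz₂) (hmem hw₂))
      (hmem hz₁) (hmem (by simpa using hσ0))
  have hd0 := (h₂ 0 h0).deriv Metric.isOpen_ball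
  have hB : ‖(f 0 z₂ - deriv (f 0) 0 * z₂) - (f 0 w₂ - deriv (f 0) 0 * w₂)‖ ≤
      8 * M / ρ ^ 2 * σ * ‖z₂ - w₂‖ := by
    have hdf : ∀ z ∈ closedBall (0 : ℂ) σ, HasDerivAt (fun z => f 0 z - deriv (f 0) 0 * z)
        (deriv (f 0) z - deriv (f 0) 0) z := fun z hz => by
      have := ((h₂ 0 h0).differentiableAt (Metric.isOpen_ball.mem_nhds
        (hmem' (mem_closedBall_zero_iff.1 hz)))).hasDerivAt
      simpa using this.fun_sub ((hasDerivAt_id z).const_mul (deriv (f 0) 0))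
    refine Convex.norm_image_sub_le_of_norm_deriv_le (s := closedBall (0 : ℂ) σ)
      (fun z hz => (hdf z hz).differentiableAt) (fun z hz => ?_) (convex_closedBall _ _)
      (mem_closedBall_zero_iff.2 hw₂) (mem_closedBall_zero_iff.2 hz₂)
    rw [(hdf z hz).deriv]
    rw [mem_closedBall_zero_iff] at hz
    have := norm_sub_le_of_norm_le (f := deriv (f 0)) (ρ := ρ / 2) (M := 2 * M / ρ) (z := z)
      (w := 0) (hd0.mono (Metric.ball_subset_ball (by linarith)))
      (fun y hy => norm_deriv_le_of_norm_le (h₂ 0 h0) (hM 0 h0) hy)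
      (by rw [mem_ball_zero_iff]; linarith) (by rw [mem_ball_zero_iff]; simp; linarith)
    refine this.trans ?_
    rw [sub_zero]
    calc 2 * (2 * M / ρ) / (ρ / 2) * ‖z‖ = 8 * M / ρ ^ 2 * ‖z‖ := by field_simp; ring
      _ ≤ _ := by gcongr
  have hsplit : f z₁ z₂ - f z₁ w₂ - deriv (f 0) 0 * (z₂ - w₂) =
      ((f z₁ z₂ - f z₁ w₂) - (f 0 z₂ - f 0 w₂)) +
      ((f 0 z₂ - deriv (f 0) 0 * z₂) - (f 0 w₂ - deriv (f 0) 0 * w₂)) := by ring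
  rw [hsplit]
  refine (norm_add_le _ _).trans ((add_le_add hA hB).trans ?_)
  rw [sub_zero]
  calc 2 * (2 * M / ρ * ‖z₂ - w₂‖) / ρ * ‖z₁‖ + 8 * M / ρ ^ 2 * σ * ‖z₂ - w₂‖
      ≤ 2 * (2 * M / ρ * ‖z₂ - w₂‖) / ρ * σ + 8 * M / ρ ^ 2 * σ * ‖z₂ - w₂‖ := by gcongr
    _ ≤ 16 * M / ρ ^ 2 * σ * ‖z₂ - w₂‖ := by
      have : 0 ≤ M / ρ ^ 2 * σ * ‖z₂ - w₂‖ := by positivity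
      have e : 2 * (2 * M / ρ * ‖z₂ - w₂‖) / ρ * σ = 4 * (M / ρ ^ 2 * σ * ‖z₂ - w₂‖) := by
        field_simp; ring
      rw [e]
      calc _ = 12 * (M / ρ ^ 2 * σ * ‖z₂ - w₂‖) := by ring
        _ ≤ 16 * (M / ρ ^ 2 * σ * ‖z₂ - w₂‖) := by gcongr; norm_num
        _ = _ := by ring

variable {T₀ R₀ ρ₀ : ℝ} {F : ℝ → ℂ → ℂ → ℂ → ℂ}

/-- Near the origin `F` differs from `λ(0,0) z₁` by a function whose Lipschitz constant is
arbitrarily small in `z₁`, and is `|b(t,x)| + O(|z₁| + |z₂|)` in `z₂`. -/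
lemma Conditions.exists_lipschitz (hT₀ : 0 < T₀) (hR₀ : 0 < R₀) (hρ₀ : 0 < ρ₀)
    (hF : Conditions T₀ R₀ ρ₀ F) {ε : ℝ} (hε : 0 < ε) :
    ∃ δ > 0, δ ≤ T₀ ∧ δ ≤ R₀ ∧ δ ≤ ρ₀ ∧ ∃ C > 0, ∀ t ∈ Icc 0 δ, ∀ x ∈ ball (0 : ℂ) δ,
      ∀ σ < δ, ∀ z₁ z₂ w₁ w₂ : ℂ, ‖z₁‖ ≤ σ → ‖z₂‖ ≤ σ → ‖w₁‖ ≤ σ → ‖w₂‖ ≤ σ →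
      ‖F t x z₁ z₂ - F t x w₁ w₂ - coeffLambda F 0 0 * (z₁ - w₁)‖ ≤
        ε * ‖z₁ - w₁‖ + (‖coeffB F t x‖ + C * σ) * ‖z₂ - w₂‖ := by
  have hb0 : ∀ {r : ℝ}, 0 < r → (0 : ℂ) ∈ ball (0 : ℂ) r := fun hr => Metric.mem_ball_self hr
  -- Joint continuity of `∂F/∂z₁` at the origin.
  let A : Set (ℝ × ℂ × ℂ) := Icc 0 T₀ ×ˢ ball 0 R₀ ×ˢ ball 0 ρ₀
  have hhol₁ : ∀ t ∈ Icc 0 T₀, ∀ x ∈ ball (0 : ℂ) R₀, ∀ z₂ ∈ ball (0 : ℂ) ρ₀,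
      DifferentiableOn ℂ (fun z₁ => F t x z₁ z₂) (ball 0 ρ₀) := fun t ht x hx z₂ hz₂ =>
    (hF.holomorphic t ht).comp (f := fun z₁ : ℂ => (x, z₁, z₂)) (by fun_prop)
      fun z₁ hz₁ => ⟨hx, hz₁, hz₂⟩
  have hhol₂ : ∀ t ∈ Icc 0 T₀, ∀ x ∈ ball (0 : ℂ) R₀, ∀ z₁ ∈ ball (0 : ℂ) ρ₀,
      DifferentiableOn ℂ (fun z₂ => F t x z₁ z₂) (ball 0 ρ₀) := fun t ht x hx z₁ hz₁ =>
    (hF.holomorphic t ht).comp (f := fun z₂ : ℂ => (x, z₁, z₂)) (by fun_prop)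
      fun z₂ hz₂ => ⟨hx, hz₁, hz₂⟩
  have hcd := continuousOn_deriv_param (A := A) (c := 0) (s := ρ₀)
    (f := fun p z₁ => F p.1 p.2.1 z₁ p.2.2)
    (hF.continuousOn.comp (f := fun q : (ℝ × ℂ × ℂ) × ℂ => (q.1.1, q.1.2.1, q.2, q.1.2.2))
      (by fun_prop) fun q hq => ⟨hq.1.1, hq.1.2.1, hq.2, hq.1.2.2⟩)
    (fun p hp => hhol₁ p.1 hp.1 p.2.1 hp.2.1 p.2.2 hp.2.2)
  have hcw := hcd ((0, 0, 0), 0)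
    ⟨⟨left_mem_Icc.2 hT₀.le, hb0 hR₀, hb0 hρ₀⟩, hb0 hρ₀⟩
  obtain ⟨d, hd, hdε⟩ := Metric.continuousWithinAt_iff.1 hcw ε hε
  obtain ⟨M, hM⟩ := (isCompact_Icc.prod ((isCompact_closedBall (0 : ℂ) (R₀ / 2)).prod
    ((isCompact_closedBall (0 : ℂ) (ρ₀ / 2)).prod (isCompact_closedBall (0 : ℂ) (ρ₀ / 2))))
    ).exists_bound_of_continuousOn (hF.continuousOn.mono (prod_mono_right
      (prod_mono (Metric.closedBall_subset_ball (by linarith))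
        (prod_mono (Metric.closedBall_subset_ball (by linarith))
          (Metric.closedBall_subset_ball (by linarith))))))
  have hM' : ∀ t ∈ Icc 0 T₀, ∀ x ∈ ball (0 : ℂ) (R₀ / 2), ∀ z₁ ∈ ball (0 : ℂ) (ρ₀ / 2),
      ∀ z₂ ∈ ball (0 : ℂ) (ρ₀ / 2), ‖F t x z₁ z₂‖ ≤ M := fun t ht x hx z₁ hz₁ z₂ hz₂ =>
    hM (t, x, z₁, z₂) ⟨ht, Metric.ball_subset_closedBall hx, Metric.ball_subset_closedBall hz₁,
      Metric.ball_subset_closedBall hz₂⟩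
  have hM0 : 0 ≤ M := (norm_nonneg _).trans (hM' 0 (left_mem_Icc.2 hT₀.le) 0 (hb0 (by linarith))
    0 (hb0 (by linarith)) 0 (hb0 (by linarith)))
  obtain ⟨δ, hδ, h1⟩ : ∃ δ > 0, δ ≤ min (min T₀ (R₀ / 2)) (min (ρ₀ / 8) (d / 2)) :=
    ⟨_, by positivity, le_rfl⟩
  simp only [le_min_iff] at h1
  obtain ⟨⟨hδT, hδR⟩, hδρ, hδd⟩ := h1
  refine ⟨δ, hδ, hδT, by linarith, by linarith, 16 * M / (ρ₀ / 2) ^ 2 + 1, by positivity, ?_⟩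
  intro t ht x hx σ hσ z₁ z₂ w₁ w₂ hz₁ hz₂ hw₁ hw₂
  have ht' : t ∈ Icc 0 T₀ := ⟨ht.1, ht.2.trans hδT⟩
  have hx' : x ∈ ball (0 : ℂ) (R₀ / 2) := Metric.ball_subset_ball hδR hx
  have hx'' : x ∈ ball (0 : ℂ) R₀ := Metric.ball_subset_ball (by linarith) hx'
  have hsub : ball (0 : ℂ) (ρ₀ / 2) ⊆ ball 0 ρ₀ := Metric.ball_subset_ball (by linarith)
  have hσ0 : 0 ≤ σ := (norm_nonneg _).trans hz₁
  have hin : ∀ {z : ℂ}, ‖z‖ ≤ σ → z ∈ ball (0 : ℂ) ρ₀ := fun hz => by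
    rw [mem_ball_zero_iff]; linarith
  have hZ : ‖F t x z₁ z₂ - F t x w₁ z₂ - coeffLambda F 0 0 * (z₁ - w₁)‖ ≤ ε * ‖z₁ - w₁‖ := by
    have hdf : ∀ z ∈ ball (0 : ℂ) δ, HasDerivAt (fun z => F t x z z₂ - coeffLambda F 0 0 * z)
        (deriv (fun z => F t x z z₂) z - coeffLambda F 0 0) z := fun z hz => by
      have := ((hhol₁ t ht' x hx'' z₂ (hin hz₂)).differentiableAt (Metric.isOpen_ball.mem_nhds
        (Metric.ball_subset_ball (by linarith) hz))).hasDerivAt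
      simpa using this.fun_sub ((hasDerivAt_id z).const_mul (coeffLambda F 0 0))
    have := Convex.norm_image_sub_le_of_norm_deriv_le (s := ball (0 : ℂ) δ) (C := ε)
      (fun z hz => (hdf z hz).differentiableAt) (fun z hz => ?_) (convex_ball _ _)
      (x := w₁) (y := z₁) (by rw [mem_ball_zero_iff]; linarith)
      (by rw [mem_ball_zero_iff]; linarith)
    · refine le_of_eq_of_le ?_ this
      congr 1; ring
    · rw [(hdf z hz).deriv, ← dist_eq_norm]
      refine (hdε (x := ((t, x, z₂), z)) ⟨⟨ht', hx'', hin hz₂⟩,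
        Metric.ball_subset_ball (by linarith) hz⟩ ?_).le
      rw [mem_ball_zero_iff] at hx hz
      simp only [Prod.dist_eq, dist_zero_right, max_lt_iff, Real.norm_eq_abs, abs_of_nonneg ht.1]
      refine ⟨⟨?_, ?_, ?_⟩, ?_⟩ <;> linarith [ht.2]
  have hW := norm_sub_sub_deriv_mul_le (f := F t x) (ρ := ρ₀ / 2) (M := M) (σ := σ) (by linarith)
    (fun z hz => (hhol₁ t ht' x hx'' z (hsub hz)).mono hsub)
    (fun z hz => (hhol₂ t ht' x hx'' z (hsub hz)).mono hsub)
    (fun y hy z hz => hM' t ht' x hx' y hy z hz) hw₁ hz₂ hw₂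
  have hW' : ‖F t x w₁ z₂ - F t x w₁ w₂‖ ≤
      ‖coeffB F t x‖ * ‖z₂ - w₂‖ + 16 * M / (ρ₀ / 2) ^ 2 * σ * ‖z₂ - w₂‖ := by
    have := norm_le_norm_add_norm_sub' (F t x w₁ z₂ - F t x w₁ w₂) (deriv (F t x 0) 0 * (z₂ - w₂))
    rw [norm_mul] at this
    exact this.trans (add_le_add le_rfl hW)
  have hsplit : F t x z₁ z₂ - F t x w₁ w₂ - coeffLambda F 0 0 * (z₁ - w₁) =
      (F t x z₁ z₂ - F t x w₁ z₂ - coeffLambda F 0 0 * (z₁ - w₁)) +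
      (F t x w₁ z₂ - F t x w₁ w₂) := by ring
  rw [hsplit]
  refine (norm_add_le _ _).trans ((add_le_add hZ hW').trans ?_)
  have : 0 ≤ σ * ‖z₂ - w₂‖ := by positivity
  linear_combination this

/-! ### The clock of a weight function -/

/-- The primitive `∫₀ᵗ ψ(τ)/τ dτ` of a weight function `ψ`. -/
def clock (ψ : ℝ → ℝ) (t : ℝ) : ℝ := ∫ τ in (0 : ℝ)..t, ψ τ / τ

section Clock

variable {T : ℝ} {ψ : ℝ → ℝ}

lemma IsWeight.mono {T' : ℝ} (h : IsWeight T ψ) (hT : T' ≤ T) : IsWeight T' ψ where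
  continuousOn := h.continuousOn.mono (Ioc_subset_Ioc_right hT)
  monotoneOn := h.monotoneOn.mono (Ioc_subset_Ioc_right hT)
  pos t ht := h.pos t (Ioc_subset_Ioc_right hT ht)
  integrable := h.integrable.mono_set (Ioc_subset_Ioc_right hT)

lemma IsWeight.continuousOn_div (h : IsWeight T ψ) :
    ContinuousOn (fun τ => ψ τ / τ) (Ioc 0 T) :=
  h.continuousOn.div continuousOn_id fun _ ht => ht.1.ne'

lemma IsWeight.intervalIntegrable (h : IsWeight T ψ) {s t : ℝ} (hs : s ∈ Icc 0 T)
    (ht : t ∈ Icc 0 T) : IntervalIntegrable (fun τ => ψ τ / τ) volume s t := by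
  rw [intervalIntegrable_iff]
  refine h.integrable.mono_set ?_
  rw [uIoc]
  exact Ioc_subset_Ioc (le_min hs.1 ht.1) (max_le hs.2 ht.2)

@[simp] lemma clock_zero : clock ψ 0 = 0 := by simp [clock]

lemma IsWeight.continuousOn_clock (h : IsWeight T ψ) (hT : 0 ≤ T) :
    ContinuousOn (clock ψ) (Icc 0 T) := by
  have := intervalIntegral.continuousOn_primitive_interval (f := fun τ => ψ τ / τ) (a := 0) (b := T)
    (μ := volume) (by rw [uIcc_of_le hT, integrableOn_Icc_iff_integrableOn_Ioc]; exact h.integrable)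
  rwa [uIcc_of_le hT] at this

lemma IsWeight.clock_le (h : IsWeight T ψ) {s t : ℝ} (hs : 0 ≤ s) (hst : s ≤ t) (ht : t ≤ T) :
    clock ψ s ≤ clock ψ t := by
  have h0 : (0 : ℝ) ∈ Icc 0 T := ⟨le_rfl, hs.trans (hst.trans ht)⟩
  have hsT : s ∈ Icc 0 T := ⟨hs, hst.trans ht⟩
  have := intervalIntegral.integral_add_adjacent_intervals (h.intervalIntegrable h0 hsT)
    (h.intervalIntegrable hsT ⟨hs.trans hst, ht⟩)
  rw [clock, clock, ← this, le_add_iff_nonneg_right, intervalIntegral.integral_of_le hst]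
  refine setIntegral_nonneg measurableSet_Ioc fun τ hτ => ?_
  have hτ0 : 0 < τ := hs.trans_lt hτ.1
  exact div_nonneg (h.pos τ ⟨hτ0, hτ.2.trans ht⟩).le hτ0.le

lemma IsWeight.clock_nonneg (h : IsWeight T ψ) {t : ℝ} (ht : t ∈ Icc 0 T) : 0 ≤ clock ψ t := by
  simpa using h.clock_le le_rfl ht.1 ht.2

lemma IsWeight.hasDerivAt_clock (h : IsWeight T ψ) {t : ℝ} (ht : t ∈ Ioo 0 T) :
    HasDerivAt (clock ψ) (ψ t / t) t := by
  have hnb : Ioc 0 T ∈ 𝓝 t := Ioc_mem_nhds ht.1 ht.2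
  exact intervalIntegral.integral_hasDerivAt_right
    (h.intervalIntegrable ⟨le_rfl, ht.1.le.trans ht.2.le⟩ ⟨ht.1.le, ht.2.le⟩)
    (h.continuousOn_div.stronglyMeasurableAtFilter_nhdsWithin measurableSet_Ioc t |>.filter_mono
      (by rw [nhdsWithin_eq_nhds.2 hnb])) (h.continuousOn_div.continuousAt hnb)

lemma IsWeight.exists_clock_le (h : IsWeight T ψ) (hT : 0 < T) {κ : ℝ} (hκ : 0 < κ) :
    ∃ δ ∈ Ioc 0 T, ∀ t ∈ Icc 0 δ, clock ψ t ≤ κ := by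
  have hc := (h.continuousOn_clock hT.le) 0 (left_mem_Icc.2 hT.le)
  have : ∀ᶠ t in 𝓝[Icc 0 T] (0 : ℝ), clock ψ t < κ := hc.eventually (by
    simpa using gt_mem_nhds hκ)
  obtain ⟨δ, hδ, hδκ⟩ := Metric.mem_nhdsWithin_iff.1 this
  refine ⟨min (δ / 2) T, ⟨by positivity, min_le_right _ _⟩, fun t ht => ?_⟩
  refine (hδκ ⟨?_, ht.1, ht.2.trans (min_le_right _ _)⟩ : clock ψ t < κ).le
  rw [Metric.mem_ball, Real.dist_eq, sub_zero, abs_of_nonneg ht.1]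
  linarith [ht.2.trans (min_le_left _ _)]

end Clock

/-! ### Families of holomorphic functions on a growing disc -/

/-- Functions of `(t,x)` on the domain `0 < t ≤ T`, `|x| < r(t)`, holomorphic in `x` and
continuous on each of the cylinders `[t₁,T] × D_{r(t₁)}`, `t₁ > 0`, which are contained in the
domain when `r` is increasing. Continuity on these cylinders is all that the solution operator
needs, and no regularity of `r` comes in. -/
structure HolOnTube (T : ℝ) (r : ℝ → ℝ) (u : ℝ → ℂ → ℂ) : Prop where
  continuousOn : ∀ t₁ ∈ Ioc 0 T,
    ContinuousOn (fun p : ℝ × ℂ => u p.1 p.2) (Icc t₁ T ×ˢ ball 0 (r t₁))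
  holomorphic : ∀ t ∈ Ioc 0 T, DifferentiableOn ℂ (u t) (ball 0 (r t))

namespace HolOnTube

variable {T : ℝ} {r : ℝ → ℝ} {u v : ℝ → ℂ → ℂ}

lemma mono {r' : ℝ → ℝ} (h : HolOnTube T r u) (hr : ∀ t ∈ Ioc 0 T, r' t ≤ r t) :
    HolOnTube T r' u where
  continuousOn t ht :=
    (h.continuousOn t ht).mono (prod_mono_right (Metric.ball_subset_ball (hr t ht)))
  holomorphic t ht := (h.holomorphic t ht).mono (Metric.ball_subset_ball (hr t ht))

lemma holomorphic_of_le (h : HolOnTube T r u) (hr : MonotoneOn r (Ioc 0 T)) {t₁ t : ℝ}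
    (ht₁ : t₁ ∈ Ioc 0 T) (ht : t ∈ Icc t₁ T) : DifferentiableOn ℂ (u t) (ball 0 (r t₁)) := by
  have htT : t ∈ Ioc 0 T := ⟨ht₁.1.trans_le ht.1, ht.2⟩
  exact (h.holomorphic t htT).mono (Metric.ball_subset_ball (hr ht₁ htT ht.1))

protected lemma deriv (h : HolOnTube T r u) (hr : MonotoneOn r (Ioc 0 T)) :
    HolOnTube T r (fun t => deriv (u t)) where
  continuousOn t₁ ht₁ := continuousOn_deriv_param (h.continuousOn t₁ ht₁)
    fun _ ht => h.holomorphic_of_le hr ht₁ ht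
  holomorphic t ht := (h.holomorphic t ht).deriv Metric.isOpen_ball

protected lemma sub (hu : HolOnTube T r u) (hv : HolOnTube T r v) :
    HolOnTube T r (fun t x => u t x - v t x) where
  continuousOn t ht := (hu.continuousOn t ht).sub (hv.continuousOn t ht)
  holomorphic t ht := (hu.holomorphic t ht).sub (hv.holomorphic t ht)

lemma const_mul (hu : HolOnTube T r u) (c : ℂ) : HolOnTube T r (fun t x => c * u t x) where
  continuousOn t ht := continuousOn_const.mul (hu.continuousOn t ht)
  holomorphic t ht := (hu.holomorphic t ht).const_mul c

lemma comp {F : ℝ → ℂ → ℂ → ℂ → ℂ} {ρ s : ℝ}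
    (hFc : ContinuousOn (fun p : ℝ × ℂ × ℂ × ℂ => F p.1 p.2.1 p.2.2.1 p.2.2.2)
      (Icc 0 T ×ˢ ball 0 ρ ×ˢ ball 0 s ×ˢ ball 0 s))
    (hFh : ∀ t ∈ Icc 0 T, DifferentiableOn ℂ (fun p : ℂ × ℂ × ℂ => F t p.1 p.2.1 p.2.2)
      (ball 0 ρ ×ˢ ball 0 s ×ˢ ball 0 s))
    (hr : MonotoneOn r (Ioc 0 T)) (hrρ : ∀ t ∈ Ioc 0 T, r t ≤ ρ)
    (hu : HolOnTube T r u) (hv : HolOnTube T r v)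
    (hus : ∀ t ∈ Ioc 0 T, ∀ x ∈ ball (0 : ℂ) (r t), ‖u t x‖ < s)
    (hvs : ∀ t ∈ Ioc 0 T, ∀ x ∈ ball (0 : ℂ) (r t), ‖v t x‖ < s) :
    HolOnTube T r (fun t x => F t x (u t x) (v t x)) where
  continuousOn t₁ ht₁ := by
    refine hFc.comp (f := fun p : ℝ × ℂ => (p.1, p.2, u p.1 p.2, v p.1 p.2))
      (continuousOn_fst.prodMk (continuousOn_snd.prodMk
        ((hu.continuousOn t₁ ht₁).prodMk (hv.continuousOn t₁ ht₁)))) ?_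
    rintro ⟨t, x⟩ ⟨ht, hx⟩
    have htT : t ∈ Ioc 0 T := ⟨ht₁.1.trans_le ht.1, ht.2⟩
    have hx' := Metric.ball_subset_ball (hr ht₁ htT ht.1) hx
    exact ⟨⟨htT.1.le, htT.2⟩, Metric.ball_subset_ball (hrρ t₁ ht₁) hx,
      mem_ball_zero_iff.2 (hus t htT x hx'), mem_ball_zero_iff.2 (hvs t htT x hx')⟩
  holomorphic t ht := by
    refine (hFh t ⟨ht.1.le, ht.2⟩).comp (f := fun x : ℂ => (x, u t x, v t x))
      (differentiableOn_id.prodMk ((hu.holomorphic t ht).prodMk (hv.holomorphic t ht))) ?_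
    exact fun x hx => ⟨Metric.ball_subset_ball (hrρ t ht) hx,
      mem_ball_zero_iff.2 (hus t ht x hx), mem_ball_zero_iff.2 (hvs t ht x hx)⟩

lemma continuousOn_section (hu : HolOnTube T r u) {t : ℝ} (ht : t ∈ Ioc 0 T) {x : ℂ}
    (hx : x ∈ ball (0 : ℂ) (r t)) : ContinuousOn (fun τ => u τ x) (Icc t T) :=
  (hu.continuousOn t ht).comp (f := fun τ => (τ, x)) (by fun_prop) fun _ hτ => ⟨hτ, hx⟩

end HolOnTube

/-! ### The solution operator of the linear model equation -/

/-- The solution of `t ∂u/∂t = λ u + g` with `u(T,x) = 0`. -/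
def duhamel (lam : ℂ) (T : ℝ) (g : ℝ → ℂ → ℂ) (t : ℝ) (x : ℂ) : ℂ :=
  -((t : ℂ) ^ lam * ∫ τ in t..T, (τ : ℂ) ^ (-lam - 1) * g τ x)

section Duhamel

variable {lam : ℂ} {T : ℝ}

lemma continuousOn_ofReal_cpow (c : ℂ) : ContinuousOn (fun τ : ℝ => (τ : ℂ) ^ c) (Ioi 0) :=
  fun _ hτ => (Complex.continuousAt_ofReal_cpow_const _ _ (.inr (ne_of_gt hτ))).continuousWithinAt

protected lemma HolOnTube.duhamel {r : ℝ → ℝ} {g : ℝ → ℂ → ℂ} (hr : MonotoneOn r (Ioc 0 T))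
    (hg : HolOnTube T r g) : HolOnTube T r (duhamel lam T g) := by
  let k : ℝ → ℂ → ℂ := fun τ x => (τ : ℂ) ^ (-lam - 1) * g τ x
  have hpow : ∀ c : ℂ, ∀ t₁ ∈ Ioc 0 T, ContinuousOn (fun p : ℝ × ℂ => (p.1 : ℂ) ^ c)
      (Icc t₁ T ×ˢ ball 0 (r t₁)) := fun c t₁ ht₁ =>
    (continuousOn_ofReal_cpow c).comp (f := fun p : ℝ × ℂ => p.1) continuousOn_fst
      fun p hp => ht₁.1.trans_le hp.1.1
  have hc : ∀ t₁ ∈ Ioc 0 T, ContinuousOn (fun p : ℝ × ℂ => k p.1 p.2)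
      (Icc t₁ T ×ˢ ball 0 (r t₁)) := fun t₁ ht₁ =>
    (hpow _ t₁ ht₁).mul (hg.continuousOn t₁ ht₁)
  refine ⟨fun t₁ ht₁ => ?_, fun t ht => ?_⟩
  · exact ((hpow lam t₁ ht₁).mul (continuousOn_integral_param ht₁.2 (hc t₁ ht₁))).neg
  · have := differentiableOn_integral_param (h := k) ht.2 (hc t ht) fun τ hτ =>
      (hg.holomorphic_of_le hr ht hτ).const_mul _
    exact (this.const_mul ((t : ℂ) ^ lam)).neg

lemma hasDerivAt_duhamel (hlam : lam ≠ 0) {g : ℝ → ℂ → ℂ} {x : ℂ}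
    (hg : ContinuousOn (fun τ => g τ x) (Ioc 0 T)) {t : ℝ} (ht : t ∈ Ioo 0 T) :
    HasDerivAt (fun s => duhamel lam T g s x) ((lam * duhamel lam T g t x + g t x) / t) t := by
  have htc : (t : ℂ) ≠ 0 := Complex.ofReal_ne_zero.2 ht.1.ne'
  have hnb : Ioc 0 T ∈ 𝓝 t := Ioc_mem_nhds ht.1 ht.2
  have hk : ContinuousOn (fun τ : ℝ => (τ : ℂ) ^ (-lam - 1) * g τ x) (Ioc 0 T) :=
    ((continuousOn_ofReal_cpow _).mono fun _ h => h.1).mul hg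
  have h1 : HasDerivAt (fun s => ∫ τ in s..T, (τ : ℂ) ^ (-lam - 1) * g τ x)
      (-((t : ℂ) ^ (-lam - 1) * g t x)) t :=
    intervalIntegral.integral_hasDerivAt_left
      ((hk.mono fun τ hτ => ⟨ht.1.trans_le hτ.1, hτ.2⟩).intervalIntegrable_of_Icc ht.2.le)
      ((hk.stronglyMeasurableAtFilter_nhdsWithin measurableSet_Ioc t).filter_mono
        (by rw [nhdsWithin_eq_nhds.2 hnb])) (hk.continuousAt hnb)
  have h2 := ((hasDerivAt_ofReal_cpow_const ht.1.ne' hlam).mul h1).neg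
  refine h2.congr_deriv ?_
  have e1 : (t : ℂ) ^ (lam - 1) = (t : ℂ) ^ lam / t := by
    rw [Complex.cpow_sub _ _ htc, Complex.cpow_one]
  have e2 : (t : ℂ) ^ lam * (t : ℂ) ^ (-lam - 1) = 1 / t := by
    rw [← Complex.cpow_add _ _ htc, show lam + (-lam - 1) = -1 by ring, Complex.cpow_neg_one,
      one_div]
  simp only [BriotBouquet.duhamel]
  rw [e1]
  linear_combination g t x * e2

/-- The estimate behind the convergence of the successive approximations. The bound on `h` is, up
to the factor `τ ^ (lam.re + 1)`, the derivative of `-τ ^ (a - lam.re) / d(τ)`: a gap `a < lam.re`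
absorbs a term of order `1/d`, and the growth of `d` absorbs a term of order `1/d²`. -/
lemma norm_cpow_mul_integral_le {a K N t : ℝ} {ψ d : ℝ → ℝ} {h : ℝ → ℂ} (ht : 0 < t) (htT : t ≤ T)
    (hN : 0 ≤ N) (hψ : ContinuousOn ψ (Ioc 0 T)) (hd : ∀ τ ∈ Icc t T, 0 < d τ)
    (hdc : ContinuousOn d (Icc t T)) (hd' : ∀ τ ∈ Ioo t T, HasDerivAt d (K * (ψ τ / τ)) τ)
    (hb : ∀ τ ∈ Icc t T,
      ‖h τ‖ ≤ N * τ ^ a * ((lam.re - a) / d τ + K * ψ τ / d τ ^ 2)) :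
    ‖(t : ℂ) ^ lam * ∫ τ in t..T, (τ : ℂ) ^ (-lam - 1) * h τ‖ ≤ N * t ^ a / d t := by
  have hpos : ∀ τ ∈ Icc t T, 0 < τ := fun τ hτ => ht.trans_le hτ.1
  have hrc : ∀ c : ℝ, ContinuousOn (fun τ : ℝ => τ ^ c) (Icc t T) := fun c =>
    continuousOn_id.rpow_const fun τ hτ => .inl (hpos τ hτ).ne'
  let W : ℝ → ℝ := fun τ => -(τ ^ (a - lam.re) / d τ)
  let W' : ℝ → ℝ := fun τ => τ ^ (a - lam.re - 1) * ((lam.re - a) / d τ + K * ψ τ / d τ ^ 2)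
  have hψ' : ContinuousOn ψ (Icc t T) := hψ.mono fun τ hτ => ⟨hpos τ hτ, hτ.2⟩
  have hWc : ContinuousOn W (Icc t T) := ((hrc _).div hdc fun τ hτ => (hd τ hτ).ne').neg
  have hW'c : ContinuousOn W' (Icc t T) := (hrc _).mul
    ((continuousOn_const.div hdc fun τ hτ => (hd τ hτ).ne').add
      ((continuousOn_const.mul hψ').div (hdc.pow 2) fun τ hτ => (pow_pos (hd τ hτ) 2).ne'))
  have hW'i : IntervalIntegrable W' volume t T := hW'c.intervalIntegrable_of_Icc htT
  have hder : ∀ τ ∈ Ioo t T, HasDerivAt W (W' τ) τ := fun τ hτ => by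
    have hτ' := Ioo_subset_Icc_self hτ
    have hτ0 := hpos τ hτ'
    have hdτ := hd τ hτ'
    refine (((Real.hasDerivAt_rpow_const (p := a - lam.re) (.inl hτ0.ne')).div (hd' τ hτ)
      hdτ.ne').neg).congr_deriv ?_
    have e : τ ^ (a - lam.re) = τ ^ (a - lam.re - 1) * τ := by
      rw [← Real.rpow_add_one hτ0.ne']; ring_nf
    simp only [W']
    rw [e]
    field_simp
    ring
  have hFTC := intervalIntegral.integral_eq_sub_of_hasDerivAt_of_le htT hWc hder hW'i
  have hle : ‖∫ τ in t..T, (τ : ℂ) ^ (-lam - 1) * h τ‖ ≤ ∫ τ in t..T, N * W' τ := by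
    refine intervalIntegral.norm_integral_le_of_norm_le htT (.of_forall fun τ hτ => ?_)
      (hW'i.const_mul N)
    have hτ' := Ioc_subset_Icc_self hτ
    have hτ0 := hpos τ hτ'
    rw [norm_mul, Complex.norm_cpow_eq_rpow_re_of_pos hτ0]
    refine (mul_le_mul_of_nonneg_left (hb τ hτ') (by positivity)).trans (le_of_eq ?_)
    have e : τ ^ (a - lam.re - 1) = τ ^ (-lam - 1).re * τ ^ a := by
      rw [← Real.rpow_add hτ0]; congr 1; simp; ring
    simp only [W']
    rw [e]; ring
  rw [norm_mul, Complex.norm_cpow_eq_rpow_re_of_pos ht]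
  rw [intervalIntegral.integral_const_mul, hFTC] at hle
  have hWT : W T ≤ 0 := neg_nonpos.2 (div_nonneg (Real.rpow_nonneg (ht.le.trans htT) _)
    (hd T ⟨htT, le_rfl⟩).le)
  have hle' : N * (W T - W t) ≤ N * (t ^ (a - lam.re) / d t) := by
    refine mul_le_mul_of_nonneg_left ?_ hN
    simp only [W] at hWT ⊢
    linarith
  refine (mul_le_mul_of_nonneg_left (hle.trans hle') (by positivity)).trans (le_of_eq ?_)
  have e : t ^ a = t ^ lam.re * t ^ (a - lam.re) := by
    rw [← Real.rpow_add ht]; congr 1; ring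
  rw [e]; ring

end Duhamel

/-! ### Successive approximations -/

/-- The right-hand side `F(t,x,u,∂u/∂x)` without its main term `λ u`. -/
def source (F : ℝ → ℂ → ℂ → ℂ → ℂ) (lam : ℂ) (u : ℝ → ℂ → ℂ) (t : ℝ) (x : ℂ) : ℂ :=
  F t x (u t x) (deriv (u t) x) - lam * u t x

/-- The successive approximations of the solution that vanishes at `t = T`. -/
def picard (F : ℝ → ℂ → ℂ → ℂ → ℂ) (lam : ℂ) (T : ℝ) : ℕ → ℝ → ℂ → ℂ
  | 0 => fun _ _ => 0
  | n + 1 => duhamel lam T (source F lam (picard F lam T n))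

/-- The radius of the disc on which the `n`-th approximation is considered at time `t`. The factor
`64` is `4 * 16`: the constant `4` of Cauchy's estimate, over the contraction ratio `1/16`. -/
def radius (R : ℝ) (ψ : ℝ → ℝ) (n : ℕ) (t : ℝ) : ℝ := R + 64 * clock ψ t + R / 2 ^ n

/-- The smallness conditions on the data under which the successive approximations converge. The
constant `3 * R * A / (lam.re - a)` in `M_eq` is that of the estimate of the first approximation;
`M` bounds all approximations and their derivatives, relative to `t ^ a`. The constant in `z₁` of
the Lipschitz condition is the one that yields the contraction ratio `1/16`. -/
structure IsContractive (F : ℝ → ℂ → ℂ → ℂ → ℂ) (lam : ℂ) (a A R s T M : ℝ) (ψ : ℝ → ℝ) :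
    Prop where
  a_pos : 0 < a
  a_lt : a < lam.re
  A_nonneg : 0 ≤ A
  R_pos : 0 < R
  T_pos : 0 < T
  isWeight : IsWeight T ψ
  clock_le : ∀ t ∈ Icc 0 T, clock ψ t ≤ R / 64
  continuousOn : ContinuousOn (fun p : ℝ × ℂ × ℂ × ℂ => F p.1 p.2.1 p.2.2.1 p.2.2.2)
    (Icc 0 T ×ˢ ball 0 (3 * R) ×ˢ ball 0 s ×ˢ ball 0 s)
  holomorphic : ∀ t ∈ Icc 0 T, DifferentiableOn ℂ (fun p : ℂ × ℂ × ℂ => F t p.1 p.2.1 p.2.2)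
    (ball 0 (3 * R) ×ˢ ball 0 s ×ˢ ball 0 s)
  norm_zero_le : ∀ t ∈ Ioc 0 T, ∀ x ∈ ball (0 : ℂ) (3 * R), ‖F t x 0 0‖ ≤ A * t ^ a
  M_eq : M = 3 * R * A / (lam.re - a) * (32 / R ^ 2 + 4 / R)
  M_lt : M * T ^ a < s
  lipschitz : ∀ t ∈ Ioc 0 T, ∀ x ∈ ball (0 : ℂ) (3 * R), ∀ z₁ z₂ w₁ w₂ : ℂ,
    ‖z₁‖ ≤ M * t ^ a → ‖z₂‖ ≤ M * t ^ a → ‖w₁‖ ≤ M * t ^ a → ‖w₂‖ ≤ M * t ^ a →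
    ‖F t x z₁ z₂ - F t x w₁ w₂ - lam * (z₁ - w₁)‖ ≤
      (lam.re - a) / 16 * ‖z₁ - w₁‖ + ψ t * ‖z₂ - w₂‖

/-- A solution `u` of `t ∂u/∂t = F(t,x,u,∂u/∂x)` on `[0,T] × D_R` for which `u` and `∂u/∂x` are
`O(t^a)`; the equation is imposed for `0 < t < T` only. -/
structure IsPowSolution (F : ℝ → ℂ → ℂ → ℂ → ℂ) (a M T R : ℝ) (u : ℝ → ℂ → ℂ) : Prop where
  continuousOn : ContinuousOn (fun p : ℝ × ℂ => u p.1 p.2) (Icc 0 T ×ˢ ball 0 R)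
  holomorphic : ∀ t ∈ Icc 0 T, DifferentiableOn ℂ (u t) (ball 0 R)
  norm_le : ∀ t ∈ Icc 0 T, ∀ x ∈ ball (0 : ℂ) R, ‖u t x‖ ≤ M * t ^ a
  norm_deriv_le : ∀ t ∈ Icc 0 T, ∀ x ∈ ball (0 : ℂ) R, ‖deriv (u t) x‖ ≤ M * t ^ a
  hasDerivAt : ∀ t ∈ Ioo 0 T, ∀ x ∈ ball (0 : ℂ) R,
    HasDerivAt (fun s => u s x) (F t x (u t x) (deriv (u t) x) / t) t

/-- At `t = 0`, where the integral may diverge, the convention `0 ^ λ = 0` gives the right value. -/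
lemma duhamel_zero_left {lam : ℂ} (hlam : lam ≠ 0) (T : ℝ) (g : ℝ → ℂ → ℂ) (x : ℂ) :
    duhamel lam T g 0 x = 0 := by
  simp [duhamel, Complex.zero_cpow hlam]

/-- A function that is `O(t^a)` is continuous up to `t = 0`. -/
lemma continuousOn_Icc_of_norm_le {u : ℝ → ℂ → ℂ} {a M T R : ℝ} (ha : 0 < a)
    (hu : ∀ t₁ ∈ Ioc 0 T, ContinuousOn (fun p : ℝ × ℂ => u p.1 p.2) (Icc t₁ T ×ˢ ball 0 R))
    (hb : ∀ t ∈ Icc 0 T, ∀ x ∈ ball (0 : ℂ) R, ‖u t x‖ ≤ M * t ^ a) :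
    ContinuousOn (fun p : ℝ × ℂ => u p.1 p.2) (Icc 0 T ×ˢ ball 0 R) := by
  rintro ⟨t₀, x₀⟩ ⟨ht₀, hx₀⟩
  simp only at ht₀ hx₀
  rcases ht₀.1.eq_or_lt with h0 | h0
  · subst h0
    have hz : u 0 x₀ = 0 := by
      have := hb 0 ht₀ x₀ hx₀
      rwa [Real.zero_rpow ha.ne', mul_zero, norm_le_zero_iff] at this
    have hlim : Tendsto (fun p : ℝ × ℂ => M * p.1 ^ a)
        (𝓝[Icc 0 T ×ˢ ball 0 R] ((0 : ℝ), x₀)) (𝓝 0) := by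
      have : ContinuousAt (fun p : ℝ × ℂ => M * p.1 ^ a) ((0 : ℝ), x₀) :=
        continuousAt_const.mul (continuousAt_fst.rpow_const (.inr ha.le))
      simpa [ContinuousAt, Real.zero_rpow ha.ne'] using this.tendsto.mono_left nhdsWithin_le_nhds
    rw [ContinuousWithinAt]
    simp only [hz]
    refine squeeze_zero_norm' ?_ hlim
    filter_upwards [self_mem_nhdsWithin] with p hp using hb p.1 hp.1 p.2 hp.2
  · refine (hu (t₀ / 2) ⟨by linarith, by linarith [ht₀.2]⟩ (t₀, x₀)
      ⟨⟨by simp only; linarith, ht₀.2⟩, hx₀⟩).mono_of_mem_nhdsWithin ?_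
    have : Ioi (t₀ / 2) ×ˢ univ ∈ 𝓝 (t₀, x₀) :=
      prod_mem_nhds (Ioi_mem_nhds (by linarith)) univ_mem
    filter_upwards [self_mem_nhdsWithin, mem_nhdsWithin_of_mem_nhds this] with p hp hp'
    exact ⟨⟨(mem_Ioi.1 hp'.1).le, hp.1.2⟩, hp.2⟩

lemma radius_zero (R : ℝ) (ψ : ℝ → ℝ) (t : ℝ) : radius R ψ 0 t = 2 * R + 64 * clock ψ t := by
  simp only [radius, pow_zero, div_one]; ring

lemma radius_succ (R : ℝ) (ψ : ℝ → ℝ) (n : ℕ) (t : ℝ) :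
    radius R ψ n t = radius R ψ (n + 1) t + R / 2 ^ (n + 1) := by
  simp only [radius, pow_succ]; field_simp; ring

lemma IsWeight.monotoneOn_radius {T : ℝ} {ψ : ℝ → ℝ} (h : IsWeight T ψ) (R : ℝ) (n : ℕ) :
    MonotoneOn (radius R ψ n) (Ioc 0 T) := fun t ht t' ht' htt' => by
  have := h.clock_le ht.1.le htt' ht'.2
  simp only [radius]; linarith

/-- Nagumo's estimate of the solution operator on the growing discs. -/
lemma IsWeight.norm_cpow_mul_integral_le_radius {lam : ℂ} {a R T N : ℝ} {ψ : ℝ → ℝ}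
    (h : IsWeight T ψ) {n : ℕ} (hN : 0 ≤ N) {g : ℝ → ℂ} {x : ℂ} {t : ℝ} (ht : t ∈ Ioc 0 T)
    (hx : x ∈ ball (0 : ℂ) (radius R ψ n t))
    (hg : ∀ τ ∈ Icc t T, ‖g τ‖ ≤ N * τ ^ a * ((lam.re - a) / (radius R ψ n τ - ‖x‖) +
      64 * ψ τ / (radius R ψ n τ - ‖x‖) ^ 2)) :
    ‖(t : ℂ) ^ lam * ∫ τ in t..T, (τ : ℂ) ^ (-lam - 1) * g τ‖ ≤
      N * t ^ a / (radius R ψ n t - ‖x‖) := by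
  rw [mem_ball_zero_iff] at hx
  have hsub : Icc t T ⊆ Icc 0 T := Icc_subset_Icc_left ht.1.le
  refine norm_cpow_mul_integral_le (K := 64) (ψ := ψ) (d := fun τ => radius R ψ n τ - ‖x‖)
    ht.1 ht.2 hN h.continuousOn (fun τ hτ => ?_) ?_ (fun τ hτ => ?_) hg
  · have := h.monotoneOn_radius R n ht ⟨ht.1.trans_le hτ.1, hτ.2⟩ hτ.1
    linarith
  · have := (h.continuousOn_clock (ht.1.le.trans ht.2)).mono hsub
    exact ((continuousOn_const.add (continuousOn_const.mul this)).add continuousOn_const).sub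
      continuousOn_const
  · exact ((((h.hasDerivAt_clock ⟨ht.1.trans hτ.1, hτ.2⟩).const_mul 64).const_add
      R).add_const _).sub_const _

namespace IsContractive

variable {F : ℝ → ℂ → ℂ → ℂ → ℂ} {lam : ℂ} {a A R s T M : ℝ} {ψ : ℝ → ℝ}

lemma lam_ne_zero (h : IsContractive F lam a A R s T M ψ) : lam ≠ 0 := by
  rintro rfl
  have := h.a_lt
  rw [Complex.zero_re] at this
  linarith [h.a_pos]

lemma gap_pos (h : IsContractive F lam a A R s T M ψ) : 0 < lam.re - a := sub_pos.2 h.a_lt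

lemma M_nonneg (h : IsContractive F lam a A R s T M ψ) : 0 ≤ M := by
  have := h.gap_pos; have := h.R_pos; have := h.A_nonneg
  rw [h.M_eq]; positivity

lemma radius_le (h : IsContractive F lam a A R s T M ψ) (n : ℕ) {t : ℝ} (ht : t ∈ Ioc 0 T) :
    radius R ψ n t ≤ 3 * R := by
  have h1 := h.clock_le t (Ioc_subset_Icc_self ht)
  have h2 : R / 2 ^ n ≤ R := div_le_self h.R_pos.le (one_le_pow₀ one_le_two)
  simp only [radius]; linarith

lemma radius_succ_le (h : IsContractive F lam a A R s T M ψ) (n : ℕ) (t : ℝ) :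
    radius R ψ (n + 1) t ≤ radius R ψ n t := by
  rw [radius_succ R ψ n t]
  have := h.R_pos
  have : 0 ≤ R / 2 ^ (n + 1) := by positivity
  linarith

lemma le_radius (h : IsContractive F lam a A R s T M ψ) (n : ℕ) {t : ℝ} (ht : t ∈ Ioc 0 T) :
    R ≤ radius R ψ n t := by
  have := h.R_pos
  have h1 := h.isWeight.clock_nonneg (Ioc_subset_Icc_self ht)
  have h2 : 0 ≤ R / 2 ^ n := by positivity
  simp only [radius]; linarith

lemma mul_rpow_lt (h : IsContractive F lam a A R s T M ψ) {t : ℝ} (ht : t ∈ Ioc 0 T) :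
    M * t ^ a < s :=
  (mul_le_mul_of_nonneg_left (Real.rpow_le_rpow ht.1.le ht.2 h.a_pos.le) h.M_nonneg).trans_lt
    h.M_lt

/-- The properties of the `n`-th approximation that are carried along the induction. -/
structure StepBound (F : ℝ → ℂ → ℂ → ℂ → ℂ) (lam : ℂ) (a R T M : ℝ) (ψ : ℝ → ℝ) (n : ℕ) :
    Prop where
  holOnTube : HolOnTube T (radius R ψ n) (picard F lam T n)
  norm_le : ∀ t ∈ Ioc 0 T, ∀ x ∈ ball (0 : ℂ) (radius R ψ n t),
    ‖picard F lam T n t x‖ ≤ M * (1 - (1 / 4) ^ n) * t ^ a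
  norm_deriv_le : ∀ t ∈ Ioc 0 T, ∀ x ∈ ball (0 : ℂ) (radius R ψ n t),
    ‖deriv (picard F lam T n t) x‖ ≤ M * (1 - (1 / 4) ^ n) * t ^ a

lemma mul_one_sub_le (h : IsContractive F lam a A R s T M ψ) (n : ℕ) {t : ℝ} (ht : 0 ≤ t) :
    M * (1 - (1 / 4) ^ n) * t ^ a ≤ M * t ^ a := by
  have h1 : (0 : ℝ) ≤ (1 / 4) ^ n := by positivity
  have h2 := Real.rpow_nonneg ht a
  have := h.M_nonneg
  have : 0 ≤ M * (1 / 4) ^ n * t ^ a := by positivity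
  linarith

lemma holOnTube_source (h : IsContractive F lam a A R s T M ψ) {n : ℕ}
    (hn : StepBound F lam a R T M ψ n) :
    HolOnTube T (radius R ψ n) (source F lam (picard F lam T n)) := by
  have hr := h.isWeight.monotoneOn_radius R n
  refine (HolOnTube.comp h.continuousOn h.holomorphic hr (fun t ht => h.radius_le n ht)
    hn.holOnTube (hn.holOnTube.deriv hr) (fun t ht x hx => ?_) fun t ht x hx => ?_).sub
    (hn.holOnTube.const_mul lam)
  · exact ((hn.norm_le t ht x hx).trans (h.mul_one_sub_le n ht.1.le)).trans_lt (h.mul_rpow_lt ht)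
  · exact ((hn.norm_deriv_le t ht x hx).trans (h.mul_one_sub_le n ht.1.le)).trans_lt
      (h.mul_rpow_lt ht)

lemma holOnTube_picard_succ (h : IsContractive F lam a A R s T M ψ) {n : ℕ}
    (hn : StepBound F lam a R T M ψ n) :
    HolOnTube T (radius R ψ n) (picard F lam T (n + 1)) :=
  HolOnTube.duhamel (h.isWeight.monotoneOn_radius R n) (h.holOnTube_source hn)

/-- The estimate of the increment of the `n`-th step, which blows up at the boundary of the
disc. -/
def IncrementBound (F : ℝ → ℂ → ℂ → ℂ → ℂ) (lam : ℂ) (a A R T : ℝ) (ψ : ℝ → ℝ) (n : ℕ) : Prop :=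
  ∀ t ∈ Ioc 0 T, ∀ x ∈ ball (0 : ℂ) (radius R ψ n t),
    ‖picard F lam T (n + 1) t x - picard F lam T n t x‖ ≤
      3 * R * A / (lam.re - a) * (1 / 16) ^ n * t ^ a / (radius R ψ n t - ‖x‖)

lemma N_nonneg (h : IsContractive F lam a A R s T M ψ) : 0 ≤ 3 * R * A / (lam.re - a) := by
  have := h.gap_pos; have := h.R_pos; have := h.A_nonneg
  positivity

lemma norm_deriv_increment_le (h : IsContractive F lam a A R s T M ψ) {n : ℕ}
    (hn : StepBound F lam a R T M ψ n) (hi : IncrementBound F lam a A R T ψ n) {t : ℝ}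
    (ht : t ∈ Ioc 0 T) {x : ℂ} (hx : x ∈ ball (0 : ℂ) (radius R ψ n t)) :
    ‖deriv (picard F lam T (n + 1) t) x - deriv (picard F lam T n t) x‖ ≤
      4 * (3 * R * A / (lam.re - a) * (1 / 16) ^ n * t ^ a) / (radius R ψ n t - ‖x‖) ^ 2 := by
  have hnb := Metric.isOpen_ball.mem_nhds hx
  have h0 := hn.holOnTube.holomorphic t ht
  have h1 := (h.holOnTube_picard_succ hn).holomorphic t ht
  rw [← deriv_fun_sub (h1.differentiableAt hnb) (h0.differentiableAt hnb)]
  have := h.N_nonneg; have := Real.rpow_nonneg ht.1.le a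
  exact norm_deriv_le_of_norm_le_div (by positivity) (h1.sub h0) (fun z hz => hi t ht z hz) hx

/-- On the next, smaller disc the increments and their derivatives are geometrically small. -/
lemma increment_le (h : IsContractive F lam a A R s T M ψ) {n : ℕ}
    (hn : StepBound F lam a R T M ψ n) (hi : IncrementBound F lam a A R T ψ n) {t : ℝ}
    (ht : t ∈ Ioc 0 T) {x : ℂ} (hx : x ∈ ball (0 : ℂ) (radius R ψ (n + 1) t)) :
    ‖picard F lam T (n + 1) t x - picard F lam T n t x‖ ≤ 3 / 4 * M * (1 / 4) ^ n * t ^ a ∧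
    ‖deriv (picard F lam T (n + 1) t) x - deriv (picard F lam T n t) x‖ ≤
      3 / 4 * M * (1 / 4) ^ n * t ^ a := by
  have hx' := Metric.ball_subset_ball (h.radius_succ_le n t) hx
  have h1 := hi t ht x hx'
  have h2 := h.norm_deriv_increment_le hn hi ht hx'
  have hta := Real.rpow_nonneg ht.1.le a
  have hN := h.N_nonneg
  have hR := h.R_pos
  have hM := h.M_eq
  rw [mem_ball_zero_iff] at hx
  have hd : R / 2 ^ (n + 1) ≤ radius R ψ n t - ‖x‖ := by
    rw [radius_succ R ψ n t]; linarith
  set N := 3 * R * A / (lam.re - a)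
  have hM' : 3 / 4 * M = N * (24 / R ^ 2 + 3 / R) := by rw [hM]; ring
  have h16 : (1 / 16 : ℝ) ^ n = (1 / 4) ^ n * (1 / 4) ^ n := by
    rw [← mul_pow]; norm_num
  have h42 : (1 / 4 : ℝ) ^ n = (1 / 2) ^ n * (1 / 2) ^ n := by
    rw [← mul_pow]; norm_num
  have hle1 : (1 / 2 : ℝ) ^ n ≤ 1 := pow_le_one₀ (by norm_num) (by norm_num)
  have hinv : (2 : ℝ) ^ n * (1 / 2) ^ n = 1 := by rw [← mul_pow]; norm_num
  constructor
  · calc _ ≤ N * (1 / 16) ^ n * t ^ a / (radius R ψ n t - ‖x‖) := h1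
      _ ≤ N * (1 / 16) ^ n * t ^ a / (R / 2 ^ (n + 1)) := by gcongr
      _ = N * (2 / R) * (1 / 4) ^ n * t ^ a * ((2 ^ n * (1 / 2) ^ n) * (1 / 2) ^ n) := by
        rw [h16, pow_succ]; nth_rewrite 2 [h42]; field_simp
      _ ≤ N * (2 / R) * (1 / 4) ^ n * t ^ a * 1 := by
        rw [hinv, one_mul]; gcongr
      _ ≤ N * (24 / R ^ 2 + 3 / R) * (1 / 4) ^ n * t ^ a := by
        rw [mul_one]; gcongr
        have : 0 ≤ 24 / R ^ 2 := by positivity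
        have : 2 / R ≤ 3 / R := by gcongr; norm_num
        linarith
      _ = _ := by rw [← hM']
  · calc _ ≤ 4 * (N * (1 / 16) ^ n * t ^ a) / (radius R ψ n t - ‖x‖) ^ 2 := h2
      _ ≤ 4 * (N * (1 / 16) ^ n * t ^ a) / (R / 2 ^ (n + 1)) ^ 2 := by gcongr
      _ = N * (16 / R ^ 2) * (1 / 4) ^ n * t ^ a * (2 ^ n * (1 / 2) ^ n) ^ 2 := by
        rw [h16, pow_succ]; nth_rewrite 2 [h42]; field_simp; ring
      _ ≤ N * (24 / R ^ 2 + 3 / R) * (1 / 4) ^ n * t ^ a := by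
        rw [hinv, one_pow, mul_one]; gcongr
        have : 0 ≤ 3 / R := by positivity
        have : 16 / R ^ 2 ≤ 24 / R ^ 2 := by gcongr; norm_num
        linarith
      _ = _ := by rw [← hM']

lemma stepBound_succ (h : IsContractive F lam a A R s T M ψ) {n : ℕ}
    (hn : StepBound F lam a R T M ψ n) (hi : IncrementBound F lam a A R T ψ n) :
    StepBound F lam a R T M ψ (n + 1) := by
  have key : ∀ t : ℝ, M * (1 - (1 / 4) ^ n) * t ^ a + 3 / 4 * M * (1 / 4) ^ n * t ^ a =
      M * (1 - (1 / 4) ^ (n + 1)) * t ^ a := fun t => by rw [pow_succ]; ring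
  refine ⟨(h.holOnTube_picard_succ hn).mono fun t _ => h.radius_succ_le n t,
    fun t ht x hx => ?_, fun t ht x hx => ?_⟩
  · have hx' := Metric.ball_subset_ball (h.radius_succ_le n t) hx
    rw [← key]
    exact (norm_le_norm_add_norm_sub' _ _).trans
      (add_le_add (hn.norm_le t ht x hx') (h.increment_le hn hi ht hx).1)
  · have hx' := Metric.ball_subset_ball (h.radius_succ_le n t) hx
    rw [← key]
    exact (norm_le_norm_add_norm_sub' _ _).trans
      (add_le_add (hn.norm_deriv_le t ht x hx') (h.increment_le hn hi ht hx).2)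

lemma stepBound_zero : StepBound F lam a R T M ψ 0 := by
  refine ⟨⟨fun _ _ => continuousOn_const, fun _ _ => differentiableOn_const 0⟩, ?_, ?_⟩ <;>
  · intro t ht x hx
    simp [picard]

lemma incrementBound_zero (h : IsContractive F lam a A R s T M ψ) :
    IncrementBound F lam a A R T ψ 0 := by
  intro t ht x hx
  have hg : picard F lam T (0 + 1) t x - picard F lam T 0 t x =
      -((t : ℂ) ^ lam * ∫ τ in t..T, (τ : ℂ) ^ (-lam - 1) * F τ x 0 0) := by
    simp [picard, duhamel, source]
  rw [hg, norm_neg, pow_zero, mul_one]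
  refine h.isWeight.norm_cpow_mul_integral_le_radius h.N_nonneg ht hx fun τ hτ => ?_
  have hτT : τ ∈ Ioc 0 T := ⟨ht.1.trans_le hτ.1, hτ.2⟩
  have hr := h.isWeight.monotoneOn_radius R 0 ht hτT hτ.1
  have hr3 := h.radius_le 0 hτT
  rw [mem_ball_zero_iff] at hx
  have hd : 0 < radius R ψ 0 τ - ‖x‖ := by linarith
  have hgap := h.gap_pos
  have hA := h.A_nonneg
  have hR := h.R_pos
  have hta := Real.rpow_nonneg hτT.1.le a
  have hψ := (h.isWeight.pos τ hτT).le
  calc ‖F τ x 0 0‖ ≤ A * τ ^ a := h.norm_zero_le τ hτT x (by rw [mem_ball_zero_iff]; linarith)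
    _ = 3 * R * A / (lam.re - a) * τ ^ a * ((lam.re - a) / (3 * R)) := by field_simp
    _ ≤ 3 * R * A / (lam.re - a) * τ ^ a * ((lam.re - a) / (radius R ψ 0 τ - ‖x‖)) := by
      gcongr
      linarith [norm_nonneg x]
    _ ≤ _ := by
      have : 0 ≤ 64 * ψ τ / (radius R ψ 0 τ - ‖x‖) ^ 2 := by positivity
      gcongr
      linarith

lemma incrementBound_succ (h : IsContractive F lam a A R s T M ψ) {n : ℕ}
    (hn : StepBound F lam a R T M ψ n) (hi : IncrementBound F lam a A R T ψ n) :
    IncrementBound F lam a A R T ψ (n + 1) := by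
  intro t ht x hx
  have hn1 := h.stepBound_succ hn hi
  have hx' := Metric.ball_subset_ball (h.radius_succ_le n t) hx
  have hpow : ContinuousOn (fun τ : ℝ => (τ : ℂ) ^ (-lam - 1)) (Icc t T) :=
    (continuousOn_ofReal_cpow _).mono fun τ hτ => ht.1.trans_le hτ.1
  have hc0 := hpow.fun_mul ((h.holOnTube_source hn).continuousOn_section ht hx')
  have hc1 := hpow.fun_mul ((h.holOnTube_source hn1).continuousOn_section ht hx)
  have heq : picard F lam T (n + 1 + 1) t x - picard F lam T (n + 1) t x =
      -((t : ℂ) ^ lam * ∫ τ in t..T, (τ : ℂ) ^ (-lam - 1) *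
        (source F lam (picard F lam T (n + 1)) τ x - source F lam (picard F lam T n) τ x)) := by
    simp only [mul_sub (( _ : ℂ) ^ (-lam - 1))]
    rw [intervalIntegral.integral_sub (hc1.intervalIntegrable_of_Icc ht.2)
      (hc0.intervalIntegrable_of_Icc ht.2)]
    change duhamel lam T (source F lam (picard F lam T (n + 1))) t x -
      duhamel lam T (source F lam (picard F lam T n)) t x = _
    simp only [duhamel]
    ring
  rw [heq, norm_neg]
  have hN := h.N_nonneg
  refine h.isWeight.norm_cpow_mul_integral_le_radius (by positivity) ht hx fun τ hτ => ?_
  have hτT : τ ∈ Ioc 0 T := ⟨ht.1.trans_le hτ.1, hτ.2⟩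
  have hxτ : x ∈ ball (0 : ℂ) (radius R ψ (n + 1) τ) :=
    Metric.ball_subset_ball (h.isWeight.monotoneOn_radius R (n + 1) ht hτT hτ.1) hx
  have hxτ' := Metric.ball_subset_ball (h.radius_succ_le n τ) hxτ
  have hx3 := Metric.ball_subset_ball (h.radius_le n hτT) hxτ'
  have hlip := h.lipschitz τ hτT x hx3 (picard F lam T (n + 1) τ x)
    (deriv (picard F lam T (n + 1) τ) x) (picard F lam T n τ x) (deriv (picard F lam T n τ) x)
    ((hn1.norm_le τ hτT x hxτ).trans (h.mul_one_sub_le _ hτT.1.le))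
    ((hn1.norm_deriv_le τ hτT x hxτ).trans (h.mul_one_sub_le _ hτT.1.le))
    ((hn.norm_le τ hτT x hxτ').trans (h.mul_one_sub_le _ hτT.1.le))
    ((hn.norm_deriv_le τ hτT x hxτ').trans (h.mul_one_sub_le _ hτT.1.le))
  have h1 := hi τ hτT x hxτ'
  have h2 := h.norm_deriv_increment_le hn hi hτT hxτ'
  have hψ := (h.isWeight.pos τ hτT).le
  have hgap := h.gap_pos
  have hta := Real.rpow_nonneg hτT.1.le a
  rw [mem_ball_zero_iff] at hxτ
  have hd0 : 0 < radius R ψ (n + 1) τ - ‖x‖ := by linarith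
  have hdd : radius R ψ (n + 1) τ - ‖x‖ ≤ radius R ψ n τ - ‖x‖ := by
    linarith [h.radius_succ_le n τ]
  set N := 3 * R * A / (lam.re - a)
  have hsrc : source F lam (picard F lam T (n + 1)) τ x - source F lam (picard F lam T n) τ x =
      F τ x (picard F lam T (n + 1) τ x) (deriv (picard F lam T (n + 1) τ) x) -
      F τ x (picard F lam T n τ x) (deriv (picard F lam T n τ) x) -
      lam * (picard F lam T (n + 1) τ x - picard F lam T n τ x) := by
    simp only [source]; ring
  rw [hsrc]
  calc _ ≤ _ := hlip
    _ ≤ (lam.re - a) / 16 * (N * (1 / 16) ^ n * τ ^ a / (radius R ψ n τ - ‖x‖)) +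
        ψ τ * (4 * (N * (1 / 16) ^ n * τ ^ a) / (radius R ψ n τ - ‖x‖) ^ 2) := by gcongr
    _ ≤ (lam.re - a) / 16 * (N * (1 / 16) ^ n * τ ^ a / (radius R ψ (n + 1) τ - ‖x‖)) +
        ψ τ * (4 * (N * (1 / 16) ^ n * τ ^ a) / (radius R ψ (n + 1) τ - ‖x‖) ^ 2) := by gcongr
    _ = _ := by rw [pow_succ]; ring

lemma stepBound_and_incrementBound (h : IsContractive F lam a A R s T M ψ) (n : ℕ) :
    StepBound F lam a R T M ψ n ∧ IncrementBound F lam a A R T ψ n := by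
  induction n with
  | zero => exact ⟨stepBound_zero, h.incrementBound_zero⟩
  | succ n ih => exact ⟨h.stepBound_succ ih.1 ih.2, h.incrementBound_succ ih.1 ih.2⟩

end IsContractive

namespace IsContractive

variable {F : ℝ → ℂ → ℂ → ℂ → ℂ} {lam : ℂ} {a A R s T M : ℝ} {ψ : ℝ → ℝ}

lemma mem_ball_radius (h : IsContractive F lam a A R s T M ψ) (n : ℕ) {t : ℝ} (ht : t ∈ Ioc 0 T)
    {x : ℂ} (hx : x ∈ ball (0 : ℂ) R) : x ∈ ball (0 : ℂ) (radius R ψ n t) :=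
  Metric.ball_subset_ball (h.le_radius n ht) hx

lemma picard_zero_left (h : IsContractive F lam a A R s T M ψ) (n : ℕ) (x : ℂ) :
    picard F lam T n 0 x = 0 := by
  cases n with
  | zero => rfl
  | succ n => exact duhamel_zero_left h.lam_ne_zero _ _ _

lemma dist_picard_succ_le (h : IsContractive F lam a A R s T M ψ) (n : ℕ) {t : ℝ}
    (ht : t ∈ Icc 0 T) {x : ℂ} (hx : x ∈ ball (0 : ℂ) R) :
    dist (picard F lam T n t x) (picard F lam T (n + 1) t x) ≤
      3 / 4 * M * T ^ a * (1 / 4) ^ n := by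
  have hM := h.M_nonneg
  have hTa := Real.rpow_nonneg h.T_pos.le a
  rcases ht.1.eq_or_lt with rfl | h0
  · rw [h.picard_zero_left, h.picard_zero_left, dist_self]; positivity
  · have htT : t ∈ Ioc 0 T := ⟨h0, ht.2⟩
    have := h.stepBound_and_incrementBound n
    rw [dist_comm, dist_eq_norm]
    calc _ ≤ _ := (h.increment_le this.1 this.2 htT (h.mem_ball_radius _ htT hx)).1
      _ = 3 / 4 * M * t ^ a * (1 / 4) ^ n := by ring
      _ ≤ _ := by gcongr; exacts [h.a_pos.le, ht.2]

lemma norm_source_le (h : IsContractive F lam a A R s T M ψ) {t : ℝ} (ht : t ∈ Ioc 0 T) {x : ℂ}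
    (hx : x ∈ ball (0 : ℂ) (3 * R)) {z₁ z₂ : ℂ} (hz₁ : ‖z₁‖ ≤ M * t ^ a)
    (hz₂ : ‖z₂‖ ≤ M * t ^ a) :
    ‖F t x z₁ z₂ - lam * z₁‖ ≤ A * t ^ a + (lam.re - a) / 16 * ‖z₁‖ + ψ t * ‖z₂‖ := by
  have hM := h.M_nonneg
  have hta := Real.rpow_nonneg ht.1.le a
  have h0 : ‖(0 : ℂ)‖ ≤ M * t ^ a := by rw [norm_zero]; positivity
  have h1 := h.lipschitz t ht x hx z₁ z₂ 0 0 hz₁ hz₂ h0 h0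
  have h2 := h.norm_zero_le t ht x hx
  simp only [sub_zero] at h1
  calc _ = ‖F t x 0 0 + (F t x z₁ z₂ - F t x 0 0 - lam * z₁)‖ := by congr 1; ring
    _ ≤ _ := norm_add_le _ _
    _ ≤ _ := by linarith

/-- The successive approximations converge, to a solution on a fixed disc. -/
theorem exists_isPowSolution (h : IsContractive F lam a A R s T M ψ) :
    ∃ u, IsPowSolution F a M T R u := by
  have hq0 : (0 : ℝ) ≤ 1 / 4 := by norm_num
  have hq1 : (1 / 4 : ℝ) < 1 := by norm_num
  have hM := h.M_nonneg
  have hR3 : ball (0 : ℂ) R ⊆ ball 0 (3 * R) := Metric.ball_subset_ball (by linarith [h.R_pos])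
  let U : ℕ → ℝ → ℂ → ℂ := picard F lam T
  let u : ℝ → ℂ → ℂ := fun t x => limUnder atTop fun n => U n t x
  have hlim : ∀ t ∈ Icc 0 T, ∀ x ∈ ball (0 : ℂ) R,
      Tendsto (fun n => U n t x) atTop (𝓝 (u t x)) := fun t ht x hx =>
    (cauchySeq_of_le_geometric _ _ hq1 fun n => h.dist_picard_succ_le n ht hx).tendsto_limUnder
  have hunif : TendstoUniformlyOn (fun n (p : ℝ × ℂ) => U n p.1 p.2) (fun p => u p.1 p.2) atTop
      (Icc 0 T ×ˢ ball 0 R) := by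
    rw [Metric.tendstoUniformlyOn_iff]
    intro ε hε
    have : Tendsto (fun n : ℕ => 3 / 4 * M * T ^ a * (1 / 4) ^ n / (1 - 1 / 4)) atTop (𝓝 0) := by
      simpa using ((tendsto_pow_atTop_nhds_zero_of_lt_one hq0 hq1).const_mul
        (3 / 4 * M * T ^ a)).div_const (1 - 1 / 4)
    filter_upwards [this.eventually (gt_mem_nhds hε)] with n hn p hp
    rw [dist_comm]
    exact (dist_le_of_le_geometric_of_tendsto _ _ hq1
      (fun n => h.dist_picard_succ_le n hp.1 hp.2) (hlim p.1 hp.1 p.2 hp.2) n).trans_lt hn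
  have hstep : ∀ n, StepBound F lam a R T M ψ n := fun n => (h.stepBound_and_incrementBound n).1
  have hzero : ∀ x ∈ ball (0 : ℂ) R, u 0 x = 0 := fun x hx =>
    tendsto_nhds_unique (hlim 0 ⟨le_rfl, h.T_pos.le⟩ x hx) (by
      simp only [U, h.picard_zero_left]; exact tendsto_const_nhds)
  have hUhol : ∀ n, ∀ t ∈ Ioc 0 T, DifferentiableOn ℂ (U n t) (ball 0 R) := fun n t ht =>
    ((hstep n).holOnTube.holomorphic t ht).mono fun x hx => h.mem_ball_radius n ht hx
  have hloc : ∀ t ∈ Ioc 0 T, TendstoLocallyUniformlyOn (fun n => U n t) (u t) atTop (ball 0 R) :=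
    fun t ht => (hunif.comp (fun x : ℂ => (t, x))).mono (s' := ball 0 R)
      (fun x hx => ⟨Ioc_subset_Icc_self ht, hx⟩) |>.tendstoLocallyUniformlyOn
  have hhol : ∀ t ∈ Ioc 0 T, DifferentiableOn ℂ (u t) (ball 0 R) := fun t ht =>
    (hloc t ht).differentiableOn (.of_forall fun n => hUhol n t ht) Metric.isOpen_ball
  have hdlim : ∀ t ∈ Ioc 0 T, ∀ x ∈ ball (0 : ℂ) R,
      Tendsto (fun n => deriv (U n t) x) atTop (𝓝 (deriv (u t) x)) := fun t ht x hx =>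
    ((hloc t ht).deriv (.of_forall fun n => hUhol n t ht) Metric.isOpen_ball).tendsto_at hx
  have hUb : ∀ n, ∀ t ∈ Ioc 0 T, ∀ x ∈ ball (0 : ℂ) R, ‖U n t x‖ ≤ M * t ^ a :=
    fun n t ht x hx => ((hstep n).norm_le t ht x (h.mem_ball_radius n ht hx)).trans
      (h.mul_one_sub_le n ht.1.le)
  have hUdb : ∀ n, ∀ t ∈ Ioc 0 T, ∀ x ∈ ball (0 : ℂ) R, ‖deriv (U n t) x‖ ≤ M * t ^ a :=
    fun n t ht x hx => ((hstep n).norm_deriv_le t ht x (h.mem_ball_radius n ht hx)).trans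
      (h.mul_one_sub_le n ht.1.le)
  have hb : ∀ t ∈ Ioc 0 T, ∀ x ∈ ball (0 : ℂ) R, ‖u t x‖ ≤ M * t ^ a := fun t ht x hx =>
    le_of_tendsto (hlim t (Ioc_subset_Icc_self ht) x hx).norm (.of_forall fun n => hUb n t ht x hx)
  have hdb : ∀ t ∈ Ioc 0 T, ∀ x ∈ ball (0 : ℂ) R, ‖deriv (u t) x‖ ≤ M * t ^ a :=
    fun t ht x hx => le_of_tendsto (hdlim t ht x hx).norm (.of_forall fun n => hUdb n t ht x hx)
  have h0a : M * (0 : ℝ) ^ a = 0 := by rw [Real.zero_rpow h.a_pos.ne', mul_zero]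
  have hb' : ∀ t ∈ Icc 0 T, ∀ x ∈ ball (0 : ℂ) R, ‖u t x‖ ≤ M * t ^ a := fun t ht x hx => by
    rcases ht.1.eq_or_lt with rfl | h0
    · rw [hzero x hx, norm_zero, h0a]
    · exact hb t ⟨h0, ht.2⟩ x hx
  have hUc : ∀ n, ∀ t₁ ∈ Ioc 0 T,
      ContinuousOn (fun p : ℝ × ℂ => U n p.1 p.2) (Icc t₁ T ×ˢ ball 0 R) := fun n t₁ ht₁ =>
    ((hstep n).holOnTube.continuousOn t₁ ht₁).mono
      (prod_mono_right fun x hx => h.mem_ball_radius n ht₁ hx)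
  have huc : ∀ t₁ ∈ Ioc 0 T,
      ContinuousOn (fun p : ℝ × ℂ => u p.1 p.2) (Icc t₁ T ×ˢ ball 0 R) := fun t₁ ht₁ =>
    (hunif.mono (prod_mono_left (Icc_subset_Icc_left ht₁.1.le))).continuousOn
      (.of_forall fun n => hUc n t₁ ht₁)
  have htube : HolOnTube T (fun _ => R) u := ⟨huc, hhol⟩
  have hmono : MonotoneOn (fun _ : ℝ => R) (Ioc 0 T) := monotoneOn_const
  have hsrc : HolOnTube T (fun _ => R) (source F lam u) :=
    (HolOnTube.comp h.continuousOn h.holomorphic hmono (fun t _ => by linarith [h.R_pos])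
      htube (htube.deriv hmono) (fun t ht x hx => (hb t ht x hx).trans_lt (h.mul_rpow_lt ht))
      fun t ht x hx => (hdb t ht x hx).trans_lt (h.mul_rpow_lt ht)).sub (htube.const_mul lam)
  -- The integral equation is obtained by passing to the limit under the integral sign.
  have hint : ∀ t ∈ Ioc 0 T, ∀ x ∈ ball (0 : ℂ) R,
      u t x = duhamel lam T (source F lam u) t x := fun t ht x hx => by
    have hpow : ContinuousOn (fun τ : ℝ => (τ : ℂ) ^ (-lam - 1)) (Icc t T) :=
      (continuousOn_ofReal_cpow _).mono fun τ hτ => ht.1.trans_le hτ.1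
    have hsub : uIoc t T ⊆ Icc t T := by rw [uIoc_of_le ht.2]; exact Ioc_subset_Icc_self
    have h0 : ∀ τ ∈ Icc t T, τ ∈ Ioc 0 T := fun τ hτ => ⟨ht.1.trans_le hτ.1, hτ.2⟩
    have hra : ContinuousOn (fun τ : ℝ => τ ^ a) (Icc t T) :=
      continuousOn_id.rpow_const fun τ hτ => .inl (h0 τ hτ).1.ne'
    have hlim' : Tendsto (fun n => ∫ τ in t..T, (τ : ℂ) ^ (-lam - 1) * source F lam (U n) τ x)
        atTop (𝓝 (∫ τ in t..T, (τ : ℂ) ^ (-lam - 1) * source F lam u τ x)) := by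
      refine intervalIntegral.tendsto_integral_filter_of_dominated_convergence
        (fun τ => ‖(τ : ℂ) ^ (-lam - 1)‖ *
          (A * τ ^ a + (lam.re - a) / 16 * (M * τ ^ a) + ψ τ * (M * τ ^ a))) ?_ ?_ ?_ ?_
      · refine .of_forall fun n => ContinuousOn.aestronglyMeasurable ?_ measurableSet_uIoc
        exact (hpow.mul ((h.holOnTube_source (hstep n)).continuousOn_section ht
          (h.mem_ball_radius n ht hx))).mono hsub
      · refine .of_forall fun n => .of_forall fun τ hτ => ?_
        have hτ' := h0 τ (hsub hτ)
        rw [norm_mul]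
        have hgap := h.gap_pos
        have hψ := (h.isWeight.pos τ hτ').le
        refine mul_le_mul_of_nonneg_left ?_ (norm_nonneg _)
        refine (h.norm_source_le hτ' (hR3 hx) (hUb n τ hτ' x hx) (hUdb n τ hτ' x hx)).trans ?_
        gcongr
        exacts [hUb n τ hτ' x hx, hUdb n τ hτ' x hx]
      · refine ContinuousOn.intervalIntegrable_of_Icc ht.2 ?_
        exact hpow.norm.mul (((continuousOn_const.mul hra).add (continuousOn_const.mul
          (continuousOn_const.mul hra))).add ((h.isWeight.continuousOn.mono h0).mul
          (continuousOn_const.mul hra)))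
      · refine .of_forall fun τ hτ => ?_
        have hτ' := h0 τ (hsub hτ)
        have h1 := hlim τ (Ioc_subset_Icc_self hτ') x hx
        have h2 := hdlim τ hτ' x hx
        have hs := h.mul_rpow_lt hτ'
        have hcF := h.continuousOn (τ, x, u τ x, deriv (u τ) x)
          ⟨Ioc_subset_Icc_self hτ', hR3 hx, mem_ball_zero_iff.2 ((hb τ hτ' x hx).trans_lt hs),
            mem_ball_zero_iff.2 ((hdb τ hτ' x hx).trans_lt hs)⟩
        have h3 : Tendsto (fun n => (τ, x, U n τ x, deriv (U n τ) x)) atTop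
            (𝓝[Icc 0 T ×ˢ ball 0 (3 * R) ×ˢ ball 0 s ×ˢ ball 0 s]
              (τ, x, u τ x, deriv (u τ) x)) := by
          refine tendsto_nhdsWithin_iff.2 ⟨tendsto_const_nhds.prodMk_nhds
            (tendsto_const_nhds.prodMk_nhds (h1.prodMk_nhds h2)), .of_forall fun n => ?_⟩
          exact ⟨Ioc_subset_Icc_self hτ', hR3 hx,
            mem_ball_zero_iff.2 ((hUb n τ hτ' x hx).trans_lt hs),
            mem_ball_zero_iff.2 ((hUdb n τ hτ' x hx).trans_lt hs)⟩
        exact tendsto_const_nhds.mul ((hcF.tendsto.comp h3).sub (tendsto_const_nhds.mul h1))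
    exact tendsto_nhds_unique
      ((tendsto_add_atTop_iff_nat 1).2 (hlim t (Ioc_subset_Icc_self ht) x hx))
      (hlim'.const_mul _).neg
  refine ⟨u, continuousOn_Icc_of_norm_le h.a_pos huc hb', fun t ht => ?_, hb', fun t ht x hx => ?_,
    fun t ht x hx => ?_⟩
  · rcases ht.1.eq_or_lt with rfl | h0
    · exact (differentiableOn_const 0).congr hzero
    · exact hhol t ⟨h0, ht.2⟩
  · rcases ht.1.eq_or_lt with rfl | h0
    · have : u 0 =ᶠ[𝓝 x] fun _ => 0 := by
        filter_upwards [Metric.isOpen_ball.mem_nhds hx] with y hy using hzero y hy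
      rw [this.deriv_eq, deriv_const, norm_zero, h0a]
    · exact hdb t ⟨h0, ht.2⟩ x hx
  · have hcs : ContinuousOn (fun τ => source F lam u τ x) (Ioc 0 T) := fun τ hτ => by
      have := hsrc.continuousOn_section (t := τ / 2)
        ⟨by linarith [hτ.1], by linarith [hτ.1, hτ.2]⟩ hx
      refine (this τ ⟨by linarith [hτ.1], hτ.2⟩).mono_of_mem_nhdsWithin ?_
      filter_upwards [self_mem_nhdsWithin, mem_nhdsWithin_of_mem_nhds
        (Ioi_mem_nhds (show τ / 2 < τ by linarith [hτ.1]))] with y hy hy'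
      exact ⟨(mem_Ioi.1 hy').le, hy.2⟩
    have hD := hasDerivAt_duhamel h.lam_ne_zero hcs ht
    rw [← hint t (Ioo_subset_Ioc_self ht) x hx] at hD
    have heq : (fun s => u s x) =ᶠ[𝓝 t] fun s => duhamel lam T (source F lam u) s x := by
      filter_upwards [Ioo_mem_nhds ht.1 ht.2] with y hy using hint y (Ioo_subset_Ioc_self hy) x hx
    refine (hD.congr_of_eventuallyEq heq).congr_deriv ?_
    simp [source]

end IsContractive

/-! ### Choice of the domain -/

lemma IsWeight.const_mul_add_rpow {T : ℝ} {m : ℝ → ℝ} (h : IsWeight T m) {B D a : ℝ} (hB : 0 < B)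
    (hD : 0 ≤ D) (ha : 0 < a) : IsWeight T (fun t => B * m t + D * t ^ a) where
  continuousOn := (continuousOn_const.mul h.continuousOn).add
    (continuousOn_const.mul (continuousOn_id.rpow_const fun _ _ => .inr ha.le))
  monotoneOn s hs t ht hst := add_le_add
    (mul_le_mul_of_nonneg_left (h.monotoneOn hs ht hst) hB.le)
    (mul_le_mul_of_nonneg_left (Real.rpow_le_rpow hs.1.le hst ha.le) hD)
  pos t ht := add_pos_of_pos_of_nonneg (mul_pos hB (h.pos t ht))
    (mul_nonneg hD (Real.rpow_nonneg ht.1.le a))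
  integrable := by
    have h1 : IntegrableOn (fun τ : ℝ => τ ^ (a - 1)) (Ioc 0 T) := by
      have := intervalIntegral.intervalIntegrable_rpow' (a := 0) (b := T) (r := a - 1)
        (by linarith)
      exact (intervalIntegrable_iff.1 this).mono_set Ioc_subset_uIoc
    have h2 : IntegrableOn (fun τ => B * (m τ / τ) + D * τ ^ (a - 1)) (Ioc 0 T) :=
      (h.integrable.const_mul B).add (h1.const_mul D)
    refine h2.congr_fun (fun τ hτ => ?_) measurableSet_Ioc
    have : τ ^ (a - 1) = τ ^ a / τ := by rw [Real.rpow_sub_one hτ.1.ne']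
    simp only [this]
    ring

lemma exists_mul_rpow_lt {M c ε T₀ : ℝ} (hc : 0 < c) (hε : 0 < ε) (hT₀ : 0 < T₀) :
    ∃ T ∈ Ioc 0 T₀, ∀ t ∈ Icc 0 T, M * t ^ c < ε := by
  have hcont : ContinuousAt (fun t : ℝ => M * t ^ c) 0 :=
    continuousAt_const.mul (continuousAt_id.rpow_const (.inr hc.le))
  have h0 : ∀ᶠ t in 𝓝 (0 : ℝ), M * t ^ c < ε := hcont.eventually (gt_mem_nhds (by
    simpa [Real.zero_rpow hc.ne'] using hε))
  obtain ⟨δ, hδ, h⟩ := Metric.eventually_nhds_iff.1 h0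
  refine ⟨min (δ / 2) T₀, ⟨by positivity, min_le_right _ _⟩, fun t ht => h ?_⟩
  rw [Real.dist_eq, sub_zero, abs_of_nonneg ht.1]
  linarith [ht.2.trans (min_le_left _ _)]

section Conditions

variable {T₀ R₀ ρ₀ : ℝ} {F : ℝ → ℂ → ℂ → ℂ → ℂ} {m : ℝ → ℝ} {B : ℝ}

/-- The Lipschitz estimate of `Conditions.exists_lipschitz` in the region `|z₁|, |z₂| ≤ M t^c`,
where the Lipschitz constant in `z₂` is a weight function with a small clock. The radius is
chosen before `M` and `c`. -/
lemma Conditions.exists_lipschitz_rpow (hT₀ : 0 < T₀) (hR₀ : 0 < R₀) (hρ₀ : 0 < ρ₀)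
    (hF : Conditions T₀ R₀ ρ₀ F) (hm : IsWeight T₀ m) (hB : 0 < B)
    (hb : ∀ t ∈ Ioc 0 T₀, ∀ x ∈ ball (0 : ℂ) R₀, ‖coeffB F t x‖ ≤ B * m t)
    {ε T₁ R₁ : ℝ} (hε : 0 < ε) (hT₁ : 0 < T₁) (hR₁ : 0 < R₁) :
    ∃ R > 0, 3 * R ≤ R₀ ∧ 3 * R ≤ R₁ ∧ ∀ M c : ℝ, 0 ≤ M → 0 < c → ∃ T > 0, T ≤ T₀ ∧ T ≤ T₁ ∧
      M * T ^ c < ρ₀ ∧ ∃ ψ, IsWeight T ψ ∧ (∀ t ∈ Icc 0 T, clock ψ t ≤ R / 64) ∧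
      ∀ t ∈ Ioc 0 T, ∀ x ∈ ball (0 : ℂ) (3 * R), ∀ z₁ z₂ w₁ w₂ : ℂ,
        ‖z₁‖ ≤ M * t ^ c → ‖z₂‖ ≤ M * t ^ c → ‖w₁‖ ≤ M * t ^ c → ‖w₂‖ ≤ M * t ^ c →
        ‖F t x z₁ z₂ - F t x w₁ w₂ - coeffLambda F 0 0 * (z₁ - w₁)‖ ≤
          ε * ‖z₁ - w₁‖ + ψ t * ‖z₂ - w₂‖ := by
  obtain ⟨δ, hδ, hδT, hδR, hδρ, C, hC, hlip⟩ := hF.exists_lipschitz hT₀ hR₀ hρ₀ hε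
  obtain ⟨R, hR, hR1⟩ : ∃ R > 0, R ≤ min δ R₁ / 3 := ⟨_, by positivity, le_rfl⟩
  have hRδ : 3 * R ≤ δ := by linarith [min_le_left δ R₁]
  refine ⟨R, hR, hRδ.trans hδR, by linarith [min_le_right δ R₁], fun M c hM hc => ?_⟩
  have hψ := hm.const_mul_add_rpow (D := C * M) hB (by positivity) hc
  obtain ⟨S₁, hS₁, hclock⟩ := hψ.exists_clock_le hT₀ (show 0 < R / 64 by positivity)
  obtain ⟨S₂, hS₂, hsmall⟩ := exists_mul_rpow_lt (M := M) hc hδ (show 0 < min T₁ δ by positivity)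
  have hT : min S₁ S₂ ≤ S₂ := min_le_right _ _
  have hT0 : 0 < min S₁ S₂ := lt_min hS₁.1 hS₂.1
  have hT' : min S₁ S₂ ≤ δ := hT.trans (hS₂.2.trans (min_le_right _ _))
  refine ⟨min S₁ S₂, hT0, hT'.trans hδT, hT.trans (hS₂.2.trans (min_le_left _ _)),
    (hsmall _ ⟨hT0.le, hT⟩).trans_le hδρ, _, hψ.mono (hT'.trans hδT),
    fun t ht => hclock t ⟨ht.1, ht.2.trans (min_le_left _ _)⟩, ?_⟩
  intro t ht x hx z₁ z₂ w₁ w₂ hz₁ hz₂ hw₁ hw₂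
  have hx' : x ∈ ball (0 : ℂ) δ := Metric.ball_subset_ball hRδ hx
  refine (hlip t ⟨ht.1.le, ht.2.trans hT'⟩ x hx' (M * t ^ c) (hsmall t ⟨ht.1.le, ht.2.trans hT⟩)
    z₁ z₂ w₁ w₂ hz₁ hz₂ hw₁ hw₂).trans ?_
  have hbt := hb t ⟨ht.1, ht.2.trans (hT'.trans hδT)⟩ x (Metric.ball_subset_ball hδR hx')
  rw [← mul_assoc]
  gcongr

/-- Local solvability with an initial condition at some positive time. -/
lemma Conditions.exists_isPowSolution (hT₀ : 0 < T₀) (hR₀ : 0 < R₀) (hρ₀ : 0 < ρ₀)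
    (hF : Conditions T₀ R₀ ρ₀ F) (hm : IsWeight T₀ m) (hB : 0 < B)
    (hb : ∀ t ∈ Ioc 0 T₀, ∀ x ∈ ball (0 : ℂ) R₀, ‖coeffB F t x‖ ≤ B * m t)
    {a A : ℝ} (ha₀ : 0 < a) (haΛ : a < (coeffLambda F 0 0).re) (hA : 0 ≤ A)
    (ha : ∀ t ∈ Icc 0 T₀, ∀ x ∈ ball (0 : ℂ) R₀, ‖coeffA F t x‖ ≤ A * t ^ a) :
    ∃ T > 0, T ≤ T₀ ∧ ∃ R > 0, R ≤ R₀ ∧ ∃ M ≥ 0, M * T ^ a < ρ₀ ∧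
      ∃ u, IsPowSolution F a M T R u := by
  have hgap : 0 < (coeffLambda F 0 0).re - a := sub_pos.2 haΛ
  obtain ⟨R, hR, hRR₀, -, h⟩ := hF.exists_lipschitz_rpow hT₀ hR₀ hρ₀ hm hB hb
    (ε := ((coeffLambda F 0 0).re - a) / 16) (by positivity) hT₀ hR₀
  have hM : 0 ≤ 3 * R * A / ((coeffLambda F 0 0).re - a) * (32 / R ^ 2 + 4 / R) := by positivity
  obtain ⟨T, hT, hTT₀, -, hMT, ψ, hψ, hclock, hlip⟩ := h _ a hM ha₀
  have hsub : ball (0 : ℂ) (3 * R) ⊆ ball 0 R₀ := Metric.ball_subset_ball hRR₀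
  have hset : ball (0 : ℂ) (3 * R) ×ˢ ball (0 : ℂ) ρ₀ ×ˢ ball (0 : ℂ) ρ₀ ⊆
      ball 0 R₀ ×ˢ ball 0 ρ₀ ×ˢ ball 0 ρ₀ := prod_mono_left hsub
  have hcontr : IsContractive F (coeffLambda F 0 0) a A R ρ₀ T _ ψ :=
    { a_pos := ha₀
      a_lt := haΛ
      A_nonneg := hA
      R_pos := hR
      T_pos := hT
      isWeight := hψ
      clock_le := hclock
      continuousOn := hF.continuousOn.mono (prod_mono (Icc_subset_Icc_right hTT₀) hset)
      holomorphic := fun t ht => (hF.holomorphic t ⟨ht.1, ht.2.trans hTT₀⟩).mono hset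
      norm_zero_le := fun t ht x hx => ha t ⟨ht.1.le, ht.2.trans hTT₀⟩ x (hsub hx)
      M_eq := rfl
      M_lt := hMT
      lipschitz := hlip }
  exact ⟨T, hT, hTT₀, R, hR, by linarith, _, hM, hMT, hcontr.exists_isPowSolution⟩

end Conditions

/-! ### Regularity of solutions -/

namespace IsPowSolution

variable {T₀ R₀ ρ₀ : ℝ} {F : ℝ → ℂ → ℂ → ℂ → ℂ} {a M T R : ℝ} {u : ℝ → ℂ → ℂ}

lemma eq_zero (h : IsPowSolution F a M T R u) (ha : a ≠ 0) (hT : 0 ≤ T) {x : ℂ}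
    (hx : x ∈ ball (0 : ℂ) R) : u 0 x = 0 ∧ deriv (u 0) x = 0 := by
  have h1 := h.norm_le 0 ⟨le_rfl, hT⟩ x hx
  have h2 := h.norm_deriv_le 0 ⟨le_rfl, hT⟩ x hx
  rw [Real.zero_rpow ha, mul_zero, norm_le_zero_iff] at h1 h2
  exact ⟨h1, h2⟩

lemma mono {T' R' : ℝ} (h : IsPowSolution F a M T R u) (hT : T' ≤ T) (hR : R' ≤ R) :
    IsPowSolution F a M T' R' u := by
  have hR' : ball (0 : ℂ) R' ⊆ ball 0 R := Metric.ball_subset_ball hR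
  exact ⟨h.continuousOn.mono (prod_mono (Icc_subset_Icc_right hT) hR'),
    fun t ht => (h.holomorphic t (Icc_subset_Icc_right hT ht)).mono hR',
    fun t ht x hx => h.norm_le t (Icc_subset_Icc_right hT ht) x (hR' hx),
    fun t ht x hx => h.norm_deriv_le t (Icc_subset_Icc_right hT ht) x (hR' hx),
    fun t ht x hx => h.hasDerivAt t (Ioo_subset_Ioo_right hT ht) x (hR' hx)⟩

lemma mul_rpow_lt (ha : 0 < a) (hM : 0 ≤ M) (hMT : M * T ^ a < ρ₀) {t : ℝ} (ht : t ∈ Icc 0 T) :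
    M * t ^ a < ρ₀ :=
  (mul_le_mul_of_nonneg_left (Real.rpow_le_rpow ht.1 ht.2 ha.le) hM).trans_lt hMT

/-- The right-hand side of the equation, along a solution, is of class `X₀`. -/
lemma memX0_rhs (h : IsPowSolution F a M T R u) (hF : Conditions T₀ R₀ ρ₀ F) (hTT₀ : T ≤ T₀)
    (hRR₀ : R ≤ R₀) (ha : 0 < a) (hM : 0 ≤ M) (hMT : M * T ^ a < ρ₀) :
    MemX0 T R (fun t x => F t x (u t x) (deriv (u t) x)) := by
  have hdc : ContinuousOn (fun p : ℝ × ℂ => deriv (u p.1) p.2) (Icc 0 T ×ˢ ball 0 R) :=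
    continuousOn_deriv_param h.continuousOn h.holomorphic
  have hmaps : ∀ t ∈ Icc 0 T, ∀ x ∈ ball (0 : ℂ) R,
      (x, u t x, deriv (u t) x) ∈ ball (0 : ℂ) R₀ ×ˢ ball (0 : ℂ) ρ₀ ×ˢ ball (0 : ℂ) ρ₀ :=
    fun t ht x hx => ⟨Metric.ball_subset_ball hRR₀ hx,
      mem_ball_zero_iff.2 ((h.norm_le t ht x hx).trans_lt (mul_rpow_lt ha hM hMT ht)),
      mem_ball_zero_iff.2 ((h.norm_deriv_le t ht x hx).trans_lt (mul_rpow_lt ha hM hMT ht))⟩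
  refine ⟨hF.continuousOn.comp (f := fun p : ℝ × ℂ => (p.1, p.2, u p.1 p.2, deriv (u p.1) p.2))
    (continuousOn_fst.prodMk (continuousOn_snd.prodMk (h.continuousOn.prodMk hdc)))
    fun p hp => ⟨⟨hp.1.1, hp.1.2.trans hTT₀⟩, hmaps p.1 hp.1 p.2 hp.2⟩, fun t ht => ?_⟩
  exact (hF.holomorphic t ⟨ht.1, ht.2.trans hTT₀⟩).comp
    (f := fun x : ℂ => (x, u t x, deriv (u t) x))
    (differentiableOn_id.prodMk ((h.holomorphic t ht).prodMk
      ((h.holomorphic t ht).deriv Metric.isOpen_ball))) fun x hx => hmaps t ht x hx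

/-- The equation also holds at `t = 0`, and up to the end of a shorter time interval. -/
lemma eulerT_eq (h : IsPowSolution F a M T R u) (hF : Conditions T₀ R₀ ρ₀ F) (hRR₀ : R ≤ R₀)
    (ha : 0 < a) {T' : ℝ} (hT' : 0 < T') (hT'T : T' < T) {t : ℝ} (ht : t ∈ Icc 0 T') {x : ℂ}
    (hx : x ∈ ball (0 : ℂ) R) : eulerT T' u t x = F t x (u t x) (deriv (u t) x) := by
  rcases ht.1.eq_or_lt with rfl | h0
  · obtain ⟨h1, h2⟩ := h.eq_zero ha.ne' (hT'.trans hT'T).le hx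
    rw [h1, h2, hF.zero_at_zero x (Metric.ball_subset_ball hRR₀ hx), eulerT, Complex.ofReal_zero,
      zero_mul]
  · have hd := (h.hasDerivAt t ⟨h0, ht.2.trans_lt hT'T⟩ x hx).hasDerivWithinAt (s := Icc 0 T')
    rw [eulerT, hd.derivWithin (uniqueDiffOn_Icc hT' t ht)]
    exact mul_div_cancel₀ _ (Complex.ofReal_ne_zero.2 h0.ne')

lemma memX1 (h : IsPowSolution F a M T R u) (hF : Conditions T₀ R₀ ρ₀ F) (hTT₀ : T ≤ T₀)
    (hRR₀ : R ≤ R₀) (ha : 0 < a) (hM : 0 ≤ M) (hMT : M * T ^ a < ρ₀) {T' : ℝ} (hT' : 0 < T')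
    (hT'T : T' < T) : MemX1 T' R u := by
  have hG := h.memX0_rhs hF hTT₀ hRR₀ ha hM hMT
  have hsub : Icc 0 T' ⊆ Icc 0 T := Icc_subset_Icc_right hT'T.le
  have hsub' : Ioo 0 T' ×ˢ ball (0 : ℂ) R ⊆ Icc 0 T ×ˢ ball 0 R :=
    prod_mono_left (Ioo_subset_Icc_self.trans hsub)
  refine ⟨⟨h.continuousOn.mono (prod_mono_left hsub), fun t ht => h.holomorphic t (hsub ht)⟩,
    ?_, fun t ht x hx => ?_, ?_, fun t ht => ?_⟩
  · refine contDiffOn_one_of_partials (ut := fun t x => F t x (u t x) (deriv (u t) x) / t)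
      (ux := fun t => deriv (u t)) (isOpen_Ioo.prod Metric.isOpen_ball)
      (fun p hp => h.hasDerivAt p.1 ⟨hp.1.1, hp.1.2.trans hT'T⟩ p.2 hp.2) (fun p hp => ?_) ?_ ?_
    · exact ((h.holomorphic p.1 (hsub (Ioo_subset_Icc_self hp.1))).differentiableAt
        (Metric.isOpen_ball.mem_nhds hp.2)).hasDerivAt
    · refine (hG.continuousOn.mono hsub').div (Continuous.continuousOn (by fun_prop)) fun p hp => ?_
      exact Complex.ofReal_ne_zero.2 hp.1.1.ne'
    · exact (continuousOn_deriv_param h.continuousOn h.holomorphic).mono hsub'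
  · exact (h.hasDerivAt t ⟨ht.1, ht.2.trans_lt hT'T⟩ x hx).differentiableAt.differentiableWithinAt
      |>.restrictScalars ℝ
  · exact (hG.continuousOn.mono (prod_mono_left hsub)).congr fun p hp =>
      h.eulerT_eq hF hRR₀ ha hT' hT'T hp.1 hp.2
  · exact (hG.holomorphic t (hsub ht)).congr fun x hx => h.eulerT_eq hF hRR₀ ha hT' hT'T ht hx

lemma germ_mem_X1Pow (h : IsPowSolution F a M T R u) (hF : Conditions T₀ R₀ ρ₀ F) (hT : 0 < T)
    (hTT₀ : T ≤ T₀) (hR : 0 < R) (hRR₀ : R ≤ R₀) (ha : 0 < a) (hM : 0 ≤ M)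
    (hMT : M * T ^ a < ρ₀) : germ u ∈ X1Pow a := by
  refine ⟨T / 2, R, u, half_pos hT, hR, ⟨h.memX1 hF hTT₀ hRR₀ ha hM hMT (half_pos hT)
    (half_lt_self hT), M + 1, by positivity, fun t ht x hx => ?_⟩, rfl⟩
  have ht' : t ∈ Icc 0 T := ⟨ht.1, by linarith [ht.2]⟩
  have := Real.rpow_nonneg ht.1 a
  exact max_le ((h.norm_le t ht' x hx).trans (by linarith))
    ((h.norm_deriv_le t ht' x hx).trans (by linarith))

lemma isSolution (h : IsPowSolution F a M T R u) (hF : Conditions T₀ R₀ ρ₀ F)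
    (hT : 0 < T) (hTT₀ : T ≤ T₀) (hRR₀ : R ≤ R₀) (ha : 0 < a) (hM : 0 ≤ M)
    (hMT : M * T ^ a < ρ₀) : IsSolution T₀ R₀ ρ₀ F (T / 2) R u := by
  have hsub : Icc 0 (T / 2) ⊆ Icc 0 T := Icc_subset_Icc_right (by linarith)
  refine ⟨by linarith, hRR₀,
    h.memX1 hF hTT₀ hRR₀ ha hM hMT (half_pos hT) (half_lt_self hT), ?_, ?_, ?_⟩
  · exact fun t ht x hx => (h.norm_le t (hsub ht) x hx).trans_lt (mul_rpow_lt ha hM hMT (hsub ht))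
  · exact fun t ht x hx =>
      (h.norm_deriv_le t (hsub ht) x hx).trans_lt (mul_rpow_lt ha hM hMT (hsub ht))
  · intro t ht x hx
    rw [h.eulerT_eq hF hRR₀ ha (half_pos hT) (half_lt_self hT) ht hx, remainder]
    ring

end IsPowSolution

/-! ### A priori estimate of solutions -/

/-- Variation of constants: a solution in terms of its value at a positive time `S`. -/
lemma eq_cpow_mul_sub_integral {lam : ℂ} {y f : ℝ → ℂ} {t S : ℝ} (ht : 0 < t) (htS : t ≤ S)
    (hlam : lam ≠ 0) (hy : ContinuousOn y (Icc t S)) (hf : ContinuousOn f (Icc t S))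
    (hyf : ∀ τ ∈ Ioo t S, HasDerivAt y (f τ / τ) τ) :
    y t = (t : ℂ) ^ lam * ((S : ℂ) ^ (-lam) * y S) -
      (t : ℂ) ^ lam * ∫ τ in t..S, (τ : ℂ) ^ (-lam - 1) * (f τ - lam * y τ) := by
  have hpow : ∀ c : ℂ, ContinuousOn (fun τ : ℝ => (τ : ℂ) ^ c) (Icc t S) := fun c =>
    (continuousOn_ofReal_cpow c).mono fun τ hτ => ht.trans_le hτ.1
  have hFTC := intervalIntegral.integral_eq_sub_of_hasDerivAt_of_le
    (f := fun τ : ℝ => (τ : ℂ) ^ (-lam) * y τ)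
    (f' := fun τ : ℝ => (τ : ℂ) ^ (-lam - 1) * (f τ - lam * y τ)) htS ((hpow _).mul hy)
    (fun τ hτ => ?_) (((hpow _).mul (hf.sub (continuousOn_const.mul hy))).intervalIntegrable_of_Icc
      htS)
  · rw [hFTC]
    have : (t : ℂ) ^ lam * (t : ℂ) ^ (-lam) = 1 := by
      rw [← Complex.cpow_add _ _ (Complex.ofReal_ne_zero.2 ht.ne'), add_neg_cancel,
        Complex.cpow_zero]
    linear_combination -y t * this
  · have hτ0 : 0 < τ := ht.trans hτ.1
    have hτc : (τ : ℂ) ≠ 0 := Complex.ofReal_ne_zero.2 hτ0.ne'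
    refine ((hasDerivAt_ofReal_cpow_const hτ0.ne' (neg_ne_zero.2 hlam)).mul
      (hyf τ hτ)).congr_deriv ?_
    have e : (τ : ℂ) ^ (-lam) = (τ : ℂ) ^ (-lam - 1) * τ := by
      rw [Complex.cpow_sub _ _ hτc, Complex.cpow_one, div_mul_cancel₀ _ hτc]
    rw [e]
    field_simp
    ring

section APriori

variable {T₀ R₀ ρ₀ : ℝ} {F : ℝ → ℂ → ℂ → ℂ → ℂ} {m : ℝ → ℝ} {B : ℝ}

/-- The estimate of a solution by a multiple of `t^a / (r(t) - |x|)` improves itself: if it holds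
with the constant `N`, then it holds with `D + N / 16`. -/
lemma IsPowSolution.improve {a₀ M S R : ℝ} {u : ℝ → ℂ → ℂ} {ψ : ℝ → ℝ}
    (hu : IsPowSolution F a₀ M S (3 * R) u) (hR : 0 < R) (hM : 0 ≤ M)
    (hG : MemX0 S (3 * R) (fun t x => F t x (u t x) (deriv (u t) x)))
    (hψ : IsWeight S ψ) (hclock : ∀ t ∈ Icc 0 S, clock ψ t ≤ R / 64)
    {a A : ℝ} {lam : ℂ} (ha : 0 < a) (halam : a < lam.re) (hA : 0 ≤ A)
    (hF0 : ∀ t ∈ Ioc 0 S, ∀ x ∈ ball (0 : ℂ) (3 * R), ‖F t x 0 0‖ ≤ A * t ^ a)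
    (hlip : ∀ t ∈ Ioc 0 S, ∀ x ∈ ball (0 : ℂ) (3 * R), ∀ z₁ z₂ w₁ w₂ : ℂ,
      ‖z₁‖ ≤ M * t ^ a₀ → ‖z₂‖ ≤ M * t ^ a₀ → ‖w₁‖ ≤ M * t ^ a₀ → ‖w₂‖ ≤ M * t ^ a₀ →
      ‖F t x z₁ z₂ - F t x w₁ w₂ - lam * (z₁ - w₁)‖ ≤
        (lam.re - a) / 16 * ‖z₁ - w₁‖ + ψ t * ‖z₂ - w₂‖)
    {N t₀ : ℝ} (ht₀ : 0 < t₀) (hN : 0 ≤ N)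
    (hbound : ∀ t ∈ Icc t₀ S, ∀ x ∈ ball (0 : ℂ) (radius R ψ 0 t),
      ‖u t x‖ ≤ N * t ^ a / (radius R ψ 0 t - ‖x‖)) :
    ∀ t ∈ Icc t₀ S, ∀ x ∈ ball (0 : ℂ) (radius R ψ 0 t),
      ‖u t x‖ ≤ ((3 * R * (S ^ (-a) * (M * S ^ a₀)) + 3 * R * A / (lam.re - a)) + N / 16) * t ^ a /
        (radius R ψ 0 t - ‖x‖) := by
  intro t ht x hx
  have hgap : 0 < lam.re - a := sub_pos.2 halam
  have hlam : lam ≠ 0 := by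
    rintro rfl
    rw [Complex.zero_re] at halam
    linarith
  have ht0 : 0 < t := ht₀.trans_le ht.1
  have hS : 0 < S := ht0.trans_le ht.2
  have htS : t ∈ Ioc 0 S := ⟨ht0, ht.2⟩
  have hr3 : ∀ τ ∈ Ioc 0 S, radius R ψ 0 τ ≤ 3 * R := fun τ hτ => by
    rw [radius_zero]; linarith [hclock τ (Ioc_subset_Icc_self hτ)]
  have hmono := hψ.monotoneOn_radius R 0
  have hx3 : x ∈ ball (0 : ℂ) (3 * R) := Metric.ball_subset_ball (hr3 t htS) hx
  have hsub : Icc t S ⊆ Icc 0 S := Icc_subset_Icc_left ht0.le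
  have hsec : ContinuousOn (fun τ : ℝ => (τ, x)) (Icc t S) := by fun_prop
  have hrep := eq_cpow_mul_sub_integral (lam := lam) (y := fun τ => u τ x)
    (f := fun τ => F τ x (u τ x) (deriv (u τ) x)) ht0 ht.2 hlam
    (hu.continuousOn.comp hsec fun τ hτ => ⟨hsub hτ, hx3⟩)
    (hG.continuousOn.comp hsec fun τ hτ => ⟨hsub hτ, hx3⟩)
    (fun τ hτ => hu.hasDerivAt τ ⟨ht0.trans hτ.1, hτ.2⟩ x hx3)
  have hxr := mem_ball_zero_iff.1 hx
  have hd : 0 < radius R ψ 0 t - ‖x‖ := by linarith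
  have hd3 : radius R ψ 0 t - ‖x‖ ≤ 3 * R := by linarith [hr3 t htS, norm_nonneg x]
  have hta := Real.rpow_nonneg ht0.le a
  -- The contribution of the value at `t = S`.
  have h1 : ‖(t : ℂ) ^ lam * ((S : ℂ) ^ (-lam) * u S x)‖ ≤
      3 * R * (S ^ (-a) * (M * S ^ a₀)) * t ^ a / (radius R ψ 0 t - ‖x‖) := by
    rw [norm_mul, norm_mul, Complex.norm_cpow_eq_rpow_re_of_pos ht0,
      Complex.norm_cpow_eq_rpow_re_of_pos hS, Complex.neg_re]
    have hq : t ^ lam.re * S ^ (-lam.re) ≤ t ^ a * S ^ (-a) := by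
      rw [Real.rpow_neg hS.le, Real.rpow_neg hS.le, ← div_eq_mul_inv, ← div_eq_mul_inv,
        ← Real.div_rpow ht0.le hS.le, ← Real.div_rpow ht0.le hS.le]
      exact Real.rpow_le_rpow_of_exponent_ge (by positivity) ((div_le_one hS).2 ht.2) halam.le
    have hSa := Real.rpow_nonneg hS.le (-a)
    have hSa₀ := Real.rpow_nonneg hS.le a₀
    calc t ^ lam.re * (S ^ (-lam.re) * ‖u S x‖) = t ^ lam.re * S ^ (-lam.re) * ‖u S x‖ := by ring
      _ ≤ t ^ a * S ^ (-a) * (M * S ^ a₀) := by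
        gcongr
        exact hu.norm_le S ⟨hS.le, le_rfl⟩ x hx3
      _ = t ^ a * S ^ (-a) * (M * S ^ a₀) * 1 := (mul_one _).symm
      _ ≤ t ^ a * S ^ (-a) * (M * S ^ a₀) * (3 * R / (radius R ψ 0 t - ‖x‖)) := by
        gcongr
        rwa [one_le_div hd]
      _ = _ := by ring
  have h2 : ‖(t : ℂ) ^ lam * ∫ τ in t..S, (τ : ℂ) ^ (-lam - 1) *
        (F τ x (u τ x) (deriv (u τ) x) - lam * u τ x)‖ ≤
      (3 * R * A / (lam.re - a) + N / 16) * t ^ a / (radius R ψ 0 t - ‖x‖) := by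
    refine hψ.norm_cpow_mul_integral_le_radius (by positivity) htS hx fun τ hτ => ?_
    have hτS : τ ∈ Ioc 0 S := ⟨ht0.trans_le hτ.1, hτ.2⟩
    have hτ₀ : τ ∈ Icc t₀ S := ⟨ht.1.trans hτ.1, hτ.2⟩
    have hτc := Ioc_subset_Icc_self hτS
    have hxτ : x ∈ ball (0 : ℂ) (radius R ψ 0 τ) :=
      Metric.ball_subset_ball (hmono htS hτS hτ.1) hx
    have hψτ := (hψ.pos τ hτS).le
    have hτa := Real.rpow_nonneg hτS.1.le a
    have hb0 := hbound τ hτ₀ x hxτ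
    have hb1 := norm_deriv_le_of_norm_le_div (f := u τ) (N := N * τ ^ a) (by positivity)
      ((hu.holomorphic τ hτc).mono (Metric.ball_subset_ball (hr3 τ hτS)))
      (fun z hz => hbound τ hτ₀ z hz) hxτ
    have hz : ‖(0 : ℂ)‖ ≤ M * τ ^ a₀ := by
      rw [norm_zero]; have := Real.rpow_nonneg hτS.1.le a₀; positivity
    have hl := hlip τ hτS x hx3 (u τ x) (deriv (u τ) x) 0 0 (hu.norm_le τ hτc x hx3)
      (hu.norm_deriv_le τ hτc x hx3) hz hz
    simp only [sub_zero] at hl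
    rw [mem_ball_zero_iff] at hxτ
    have hdτ : 0 < radius R ψ 0 τ - ‖x‖ := by linarith
    have hdτ3 : radius R ψ 0 τ - ‖x‖ ≤ 3 * R := by linarith [hr3 τ hτS, norm_nonneg x]
    have hA' : A * τ ^ a ≤ 3 * R * A / (lam.re - a) * τ ^ a *
        ((lam.re - a) / (radius R ψ 0 τ - ‖x‖)) := by
      calc A * τ ^ a = A * τ ^ a * 1 := (mul_one _).symm
        _ ≤ A * τ ^ a * (3 * R / (radius R ψ 0 τ - ‖x‖)) := by
          gcongr
          rwa [one_le_div hdτ]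
        _ = _ := by field_simp
    have hpos : 0 ≤ 3 * R * A / (lam.re - a) * τ ^ a *
        (64 * ψ τ / (radius R ψ 0 τ - ‖x‖) ^ 2) := by positivity
    calc ‖F τ x (u τ x) (deriv (u τ) x) - lam * u τ x‖
        = ‖F τ x 0 0 + (F τ x (u τ x) (deriv (u τ) x) - F τ x 0 0 - lam * u τ x)‖ := by
          congr 1; ring
      _ ≤ A * τ ^ a + ((lam.re - a) / 16 * ‖u τ x‖ + ψ τ * ‖deriv (u τ) x‖) :=
        (norm_add_le _ _).trans (add_le_add (hF0 τ hτS x hx3) hl)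
      _ ≤ 3 * R * A / (lam.re - a) * τ ^ a * ((lam.re - a) / (radius R ψ 0 τ - ‖x‖)) +
          ((lam.re - a) / 16 * (N * τ ^ a / (radius R ψ 0 τ - ‖x‖)) +
            ψ τ * (4 * (N * τ ^ a) / (radius R ψ 0 τ - ‖x‖) ^ 2)) := by gcongr
      _ ≤ 3 * R * A / (lam.re - a) * τ ^ a * ((lam.re - a) / (radius R ψ 0 τ - ‖x‖)) +
          ((lam.re - a) / 16 * (N * τ ^ a / (radius R ψ 0 τ - ‖x‖)) +
            ψ τ * (4 * (N * τ ^ a) / (radius R ψ 0 τ - ‖x‖) ^ 2)) +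
          3 * R * A / (lam.re - a) * τ ^ a * (64 * ψ τ / (radius R ψ 0 τ - ‖x‖) ^ 2) :=
        le_add_of_nonneg_right hpos
      _ = _ := by ring
  rw [show u t x = _ from hrep]
  refine (norm_sub_le _ _).trans ((add_le_add h1 h2).trans (le_of_eq ?_))
  ring

/-- Any solution that decays like some power of `t` decays, near the origin, like every power
`t^a` with `a < Re λ(0,0)` for which the inhomogeneous term does. -/
theorem IsPowSolution.exists_of_lt (hT₀ : 0 < T₀) (hR₀ : 0 < R₀) (hρ₀ : 0 < ρ₀)
    (hF : Conditions T₀ R₀ ρ₀ F) (hm : IsWeight T₀ m) (hB : 0 < B)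
    (hb : ∀ t ∈ Ioc 0 T₀, ∀ x ∈ ball (0 : ℂ) R₀, ‖coeffB F t x‖ ≤ B * m t)
    {a A : ℝ} (ha : 0 < a) (haΛ : a < (coeffLambda F 0 0).re) (hA : 0 ≤ A)
    (haA : ∀ t ∈ Icc 0 T₀, ∀ x ∈ ball (0 : ℂ) R₀, ‖coeffA F t x‖ ≤ A * t ^ a)
    {a₀ M T R : ℝ} {u : ℝ → ℂ → ℂ} (hu : IsPowSolution F a₀ M T R u) (hT : 0 < T) (hR : 0 < R)
    (ha₀ : 0 < a₀) (hM : 0 ≤ M) :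
    ∃ T' > 0, T' ≤ T₀ ∧ ∃ R' > 0, R' ≤ R₀ ∧ ∃ M' ≥ 0, M' * T' ^ a < ρ₀ ∧
      IsPowSolution F a M' T' R' u := by
  have hgap : 0 < (coeffLambda F 0 0).re - a := sub_pos.2 haΛ
  obtain ⟨R₁, hR₁, hR₁R₀, hR₁R, h⟩ := hF.exists_lipschitz_rpow hT₀ hR₀ hρ₀ hm hB hb
    (ε := ((coeffLambda F 0 0).re - a) / 16) (by positivity) hT hR
  obtain ⟨S, hS, hST₀, hST, hMS, ψ, hψ, hclock, hlip⟩ := h M a₀ hM ha₀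
  set lam := coeffLambda F 0 0
  have hu' := hu.mono hST hR₁R
  have hG := hu'.memX0_rhs hF hST₀ hR₁R₀ ha₀ hM hMS
  have hF0 : ∀ t ∈ Ioc 0 S, ∀ x ∈ ball (0 : ℂ) (3 * R₁), ‖F t x 0 0‖ ≤ A * t ^ a :=
    fun t ht x hx => haA t ⟨ht.1.le, ht.2.trans hST₀⟩ x (Metric.ball_subset_ball hR₁R₀ hx)
  set D := 3 * R₁ * (S ^ (-a) * (M * S ^ a₀)) + 3 * R₁ * A / (lam.re - a) with hDdef
  have hD : 0 ≤ D := by positivity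
  have hr3 : ∀ τ ∈ Ioc 0 S, radius R₁ ψ 0 τ ≤ 3 * R₁ := fun τ hτ => by
    rw [radius_zero]; linarith [hclock τ (Ioc_subset_Icc_self hτ)]
  -- A bound on `[t₀, S]`, with a constant that depends on `t₀`, is improved repeatedly.
  have key : ∀ t ∈ Ioc 0 S, ∀ x ∈ ball (0 : ℂ) (radius R₁ ψ 0 t),
      ‖u t x‖ ≤ 2 * D * t ^ a / (radius R₁ ψ 0 t - ‖x‖) := by
    intro t₀ ht₀
    set N := 3 * R₁ * (M * S ^ a₀) / t₀ ^ a
    have hta₀ := Real.rpow_pos_of_pos ht₀.1 a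
    have hN : 0 ≤ N := by positivity
    have hiter : ∀ k : ℕ, ∀ t ∈ Icc t₀ S, ∀ x ∈ ball (0 : ℂ) (radius R₁ ψ 0 t),
        ‖u t x‖ ≤ (2 * D + N / 16 ^ k) * t ^ a / (radius R₁ ψ 0 t - ‖x‖) := by
      intro k
      induction k with
      | zero =>
        intro t ht x hx
        have htS : t ∈ Ioc 0 S := ⟨ht₀.1.trans_le ht.1, ht.2⟩
        have hx3 := Metric.ball_subset_ball (hr3 t htS) hx
        rw [mem_ball_zero_iff] at hx
        have hd : 0 < radius R₁ ψ 0 t - ‖x‖ := by linarith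
        have hd3 : radius R₁ ψ 0 t - ‖x‖ ≤ 3 * R₁ := by linarith [hr3 t htS, norm_nonneg x]
        have hta := Real.rpow_le_rpow ht₀.1.le ht.1 ha.le
        rw [le_div_iff₀ hd, pow_zero, div_one]
        calc ‖u t x‖ * (radius R₁ ψ 0 t - ‖x‖) ≤ (M * S ^ a₀) * (3 * R₁) := by
              refine mul_le_mul ?_ hd3 hd.le (by positivity)
              refine (hu'.norm_le t (Ioc_subset_Icc_self htS) x hx3).trans ?_
              exact mul_le_mul_of_nonneg_left (Real.rpow_le_rpow htS.1.le ht.2 ha₀.le) hM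
          _ = N * t₀ ^ a := by simp only [N]; field_simp
          _ ≤ N * t ^ a := by gcongr
          _ ≤ (2 * D + N) * t ^ a := by
            have := hta₀.le.trans hta
            gcongr
            linarith
      | succ k ih =>
        intro t ht x hx
        have hNk : 0 ≤ N / 16 ^ k := by positivity
        refine (hu'.improve hR₁ hM hG hψ hclock ha haΛ hA hF0 hlip ht₀.1 (by positivity) ih t
          ht x hx).trans ?_
        rw [← hDdef]
        have hta := Real.rpow_nonneg (ht₀.1.le.trans ht.1) a
        rw [mem_ball_zero_iff] at hx
        have hd : 0 ≤ radius R₁ ψ 0 t - ‖x‖ := by linarith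
        have hstep : D + (2 * D + N / 16 ^ k) / 16 ≤ 2 * D + N / 16 ^ (k + 1) := by
          have e : N / 16 ^ (k + 1) = N / 16 ^ k / 16 := by rw [pow_succ]; field_simp
          rw [e]
          linarith
        exact div_le_div_of_nonneg_right (mul_le_mul_of_nonneg_right hstep hta) hd
    intro x hx
    have hlim : Tendsto (fun k : ℕ => (2 * D + N / 16 ^ k) * t₀ ^ a / (radius R₁ ψ 0 t₀ - ‖x‖))
        atTop (𝓝 ((2 * D + 0) * t₀ ^ a / (radius R₁ ψ 0 t₀ - ‖x‖))) :=
      ((((tendsto_pow_atTop_atTop_of_one_lt (by norm_num)).const_div_atTop N).const_add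
        _).mul_const _).div_const _
    rw [add_zero] at hlim
    exact ge_of_tendsto hlim (.of_forall fun k => hiter k t₀ ⟨le_rfl, ht₀.2⟩ x hx)
  have hb1 : ∀ t ∈ Icc 0 S, ∀ x ∈ ball (0 : ℂ) R₁, ‖u t x‖ ≤ (2 * D / R₁ + 8 * D / R₁ ^ 2) * t ^ a ∧
      ‖deriv (u t) x‖ ≤ (2 * D / R₁ + 8 * D / R₁ ^ 2) * t ^ a := by
    intro t ht x hx
    rcases ht.1.eq_or_lt with rfl | h0
    · obtain ⟨h1, h2⟩ := hu'.eq_zero ha₀.ne' hS.le (Metric.ball_subset_ball (by linarith) hx)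
      simp [h1, h2, Real.zero_rpow ha.ne']
    · have htS : t ∈ Ioc 0 S := ⟨h0, ht.2⟩
      have hta := Real.rpow_nonneg ht.1 a
      have hr2 : 2 * R₁ ≤ radius R₁ ψ 0 t := by
        rw [radius_zero]; linarith [hψ.clock_nonneg ht]
      have hx' : x ∈ ball (0 : ℂ) (radius R₁ ψ 0 t) :=
        Metric.ball_subset_ball (by linarith) hx
      have h1 := key t htS x hx'
      have h2 := norm_deriv_le_of_norm_le_div (f := u t) (N := 2 * D * t ^ a) (by positivity)
        ((hu'.holomorphic t ht).mono (Metric.ball_subset_ball (hr3 t htS)))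
        (fun z hz => key t htS z hz) hx'
      rw [mem_ball_zero_iff] at hx
      have hd : R₁ ≤ radius R₁ ψ 0 t - ‖x‖ := by linarith
      have p1 : 0 ≤ 2 * D / R₁ * t ^ a := by positivity
      have p2 : 0 ≤ 8 * D / R₁ ^ 2 * t ^ a := by positivity
      rw [add_mul]
      constructor
      · calc ‖u t x‖ ≤ 2 * D * t ^ a / (radius R₁ ψ 0 t - ‖x‖) := h1
          _ ≤ 2 * D * t ^ a / R₁ := by gcongr
          _ = 2 * D / R₁ * t ^ a := by ring
          _ ≤ _ := by linarith
      · calc ‖deriv (u t) x‖ ≤ 4 * (2 * D * t ^ a) / (radius R₁ ψ 0 t - ‖x‖) ^ 2 := h2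
          _ ≤ 4 * (2 * D * t ^ a) / R₁ ^ 2 := by gcongr
          _ = 8 * D / R₁ ^ 2 * t ^ a := by ring
          _ ≤ _ := by linarith
  obtain ⟨T', hT', hsmall⟩ := exists_mul_rpow_lt (M := 2 * D / R₁ + 8 * D / R₁ ^ 2) ha hρ₀ hS
  refine ⟨T', hT'.1, hT'.2.trans hST₀, R₁, hR₁, by linarith, _, by positivity,
    hsmall T' ⟨hT'.1.le, le_rfl⟩, ?_⟩
  have hu'' := hu'.mono hT'.2 (show R₁ ≤ 3 * R₁ by linarith)
  exact ⟨hu''.continuousOn, hu''.holomorphic,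
    fun t ht x hx => (hb1 t ⟨ht.1, ht.2.trans hT'.2⟩ x hx).1,
    fun t ht x hx => (hb1 t ⟨ht.1, ht.2.trans hT'.2⟩ x hx).2, hu''.hasDerivAt⟩

/-- A bound by a power of `t` implies a bound by every lower power. -/
lemma norm_coeffA_le_of_le {A μ a : ℝ} (hA : 0 ≤ A) (ha₀ : 0 < a) (haμ : a ≤ μ)
    (h : ∀ t ∈ Icc 0 T₀, ∀ x ∈ ball (0 : ℂ) R₀, ‖coeffA F t x‖ ≤ A * t ^ μ) :
    ∀ t ∈ Icc 0 T₀, ∀ x ∈ ball (0 : ℂ) R₀, ‖coeffA F t x‖ ≤ A * T₀ ^ (μ - a) * t ^ a := by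
  intro t ht x hx
  refine (h t ht x hx).trans ?_
  have e : t ^ μ = t ^ (μ - a) * t ^ a := by
    rw [← Real.rpow_add_of_nonneg ht.1 (sub_nonneg.2 haμ) ha₀.le, sub_add_cancel]
  have := Real.rpow_nonneg ht.1 a
  rw [e, mul_assoc]
  gcongr
  exacts [ht.1, ht.2]

end APriori

end BriotBouquet

end

theorem theorem4p1 (T₀ R₀ ρ₀ : ℝ) (hT₀ : 0 < T₀) (hR₀ : 0 < R₀) (hρ₀ : 0 < ρ₀)
    (F : ℝ → ℂ → ℂ → ℂ → ℂ) (hF : BriotBouquet.Conditions T₀ R₀ ρ₀ F)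
    (m : ℝ → ℝ) (hm : BriotBouquet.IsWeight T₀ m)
    (A B μ : ℝ) (hA : 0 < A) (hB : 0 < B)
    (ha : ∀ t ∈ Set.Icc 0 T₀, ∀ x ∈ Metric.ball (0 : ℂ) R₀,
      ‖BriotBouquet.coeffA F t x‖ ≤ A * t ^ μ)
    (hb : ∀ t ∈ Set.Ioc 0 T₀, ∀ x ∈ Metric.ball (0 : ℂ) R₀,
      ‖BriotBouquet.coeffB F t x‖ ≤ B * m t)
    (hμ : 0 < μ) (hμ_le : μ ≤ (BriotBouquet.coeffLambda F 0 0).re) :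
    (μ < (BriotBouquet.coeffLambda F 0 0).re →
      (BriotBouquet.solutions T₀ R₀ ρ₀ F (BriotBouquet.X1Pow μ)).Nonempty) ∧
    (μ = (BriotBouquet.coeffLambda F 0 0).re →
      (BriotBouquet.solutions T₀ R₀ ρ₀ F (BriotBouquet.X1Below μ)).Nonempty) := by

  have key : ∀ a : ℝ, 0 < a → a ≤ μ → a < (BriotBouquet.coeffLambda F 0 0).re →
      ∃ u, BriotBouquet.germ u ∈ BriotBouquet.solutions T₀ R₀ ρ₀ F (BriotBouquet.X1Pow a) ∧
        ∃ T > 0, ∃ R > 0, ∃ M ≥ 0, BriotBouquet.IsPowSolution F a M T R u := by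
    intro a ha₀ haμ haΛ
    obtain ⟨T, hT, hTT₀, R, hR, hRR₀, M, hM, hMT, u, hu⟩ := hF.exists_isPowSolution hT₀ hR₀ hρ₀
      hm hB hb ha₀ haΛ (by positivity) (BriotBouquet.norm_coeffA_le_of_le hA.le ha₀ haμ ha)
    exact ⟨u, ⟨hu.germ_mem_X1Pow hF hT hTT₀ hR hRR₀ ha₀ hM hMT, T / 2, R, u, half_pos hT, hR,
      hu.isSolution hF hT hTT₀ hRR₀ ha₀ hM hMT, rfl⟩, T, hT, R, hR, M, hM, hu⟩
  refine ⟨fun hlt => ?_, fun heq => ?_⟩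
  · obtain ⟨u, hu, -⟩ := key μ hμ le_rfl hlt
    exact ⟨_, hu⟩
  · obtain ⟨u, hu, T, hT, R, hR, M, hM, hsol⟩ := key (μ / 2) (half_pos hμ) (by linarith)
      (by linarith)
    refine ⟨BriotBouquet.germ u, Set.mem_iInter₂.2 fun a ha' => ?_, hu.2⟩
    obtain ⟨T', hT', hTT', R', hR', hRR', M', hM', hMT', hu'⟩ := hsol.exists_of_lt hT₀ hR₀ hρ₀
      hF hm hB hb ha'.1 (ha'.2.trans_eq heq) (by positivity)
      (BriotBouquet.norm_coeffA_le_of_le hA.le ha'.1 ha'.2.le ha) hT hR (half_pos hμ) hM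
    exact hu'.germ_mem_X1Pow hF hT' hTT' hR' hRR' ha'.1 hM' hMT'
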